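/- Let $L$ be a first-order language containing a binary relation symbol $<$, and let $T$ be a complete $L$-theory that has infinite models and in all of whose models $<$ is a linear order. "Definable" means definable by an $L$-formula without parameters, unless parameters are mentioned. Assume that $T$ satisfies the strong linear binarity condition (SLB) for every model $M\models T$, every initial part $C\subseteq M$ (that is, $c\in C$ and $d<c$ imply $d\in C$) and every automorphism $f$ of $M$ with $f(C)=C$, the map $g$ given by $g(x)=f(x)$ for $x\in C$ and $g(x)=x$ for $x\notin C$ is an automorphism of $M$. Let $M$ be any model of $T$, let $A\subseteq M$, and let $D\subseteq M$ be definable with parameters from $A$. Then: 1. $D$ is a (finite) Boolean combination of definable subsets of $M$, intervals with endpoints in $M\cup\{\pm\infty\}$, and classes of definable convex equivalence relations on $M$ (equivalence relations on $M$ that are definable and all of whose classes are convex subsets of $(M,<)$). 2. For every complete type $q\in S_1(T)$, with set of realizations $q(M)$ in $M$, the set $D\cap q(M)$ has only finitely many convex components in the ordered set $(q(M),<)$. 3. $D$ can be partitioned into finitely many sets, each of which is definable with parameters from $A$ and is definably convex, i.e. is a convex subset of $(P,<)$ for some definable set $P\subseteq M$. In particular, $T$ is weakly quasi-o-minimal: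 every parametrically definable subset of a model of $T$ is a Boolean combination of definable sets and convex sets. -/

import Mathlib

universe u v w

namespace LinearTheory

open FirstOrder FirstOrder.Language FirstOrder.Language.Structure

/-- In the `L`-structure `M`, the binary relation symbol `lt` is interpreted by the strict order
of `M`. -/
def InterpretsLT {L : FirstOrder.Language.{u, v}} (lt : L.Relations 2)
    (M : Type w) [L.Structure M] [LinearOrder M] : Prop :=
  ∀ a b : M, RelMap lt ![a, b] ↔ a < b

/-- `T` is a theory of linearly ordered structures: in every model of `T` the symbol `lt` defines
a strict linear order. -/
def IsTheoryOfLinearOrders {L : FirstOrder.Language.{u, v}} (lt : L.Relations 2) (T : L.Theory) : Prop :=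
  ∀ M : Theory.ModelType.{u, v, max u v} T,
    IsStrictTotalOrder M fun a b => RelMap lt ![a, b]

/-- `T` has an infinite model. -/
def HasInfiniteModel {L : FirstOrder.Language.{u, v}} (T : L.Theory) : Prop :=
  ∃ M : Theory.ModelType.{u, v, max u v} T, Infinite M

/-- The strong linear binarity condition: for every model `M`, every initial part `C` of `M` and
every automorphism `f` of `M` fixing `C` setwise, the map that is `f` on `C` and the identity off
`C` is an automorphism of `M`. -/
def SLB {L : FirstOrder.Language.{u, v}} (lt : L.Relations 2) (T : L.Theory) : Prop :=
  ∀ (M : Type (max u v)) [L.Structure M] [LinearOrder M] [Nonempty M] [T.Model M],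
    InterpretsLT lt M →
    ∀ (C : Set M), IsLowerSet C → ∀ f : M ≃[L] M, f '' C = C →
      ∃ g : M ≃[L] M, (∀ x ∈ C, g x = f x) ∧ ∀ x ∉ C, g x = x

section Sets

variable (L : FirstOrder.Language.{u, v}) {M : Type w} [L.Structure M]

/-- `P` is definable in `M` without parameters. -/
def IsUnaryDefinable (P : Set M) : Prop :=
  (∅ : Set M).Definable₁ L P

variable [LinearOrder M]

/-- `I` is an open ray with endpoint in `M`. All other intervals with endpoints in `M` or `±∞` are
Boolean combinations of such rays. -/
def IsRay (I : Set M) : Prop :=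
  ∃ a : M, I = Set.Ioi a ∨ I = Set.Iio a

/-- `E` is definable without parameters and its classes are convex. -/
def IsDefinableConvexEquiv (E : Setoid M) : Prop :=
  (∅ : Set M).Definable₂ L {p : M × M | E p.1 p.2} ∧ ∀ a : M, {x | E x a}.OrdConnected

/-- `K` is a class of some parameter-free definable convex equivalence relation. -/
def IsDefinableConvexClass (K : Set M) : Prop :=
  ∃ E : Setoid M, IsDefinableConvexEquiv L E ∧ ∃ a : M, K = {x | E x a}

/-- `D` is a convex subset of the ordered set `P`, for some parameter-free definable `P`. -/
def IsDefinablyConvex (D : Set M) : Prop :=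
  ∃ P : Set M, IsUnaryDefinable L P ∧ D ⊆ P ∧
    ∀ x ∈ D, ∀ y ∈ D, ∀ z ∈ P, x ≤ z → z ≤ y → z ∈ D

end Sets

/-- The convex components, in the ordered set `X`, of `D ∩ X`. -/
def convexComponentsOn {M : Type w} [LinearOrder M] (X D : Set M) : Set (Set X) :=
  {K | ∃ x : X, (x : M) ∈ D ∧ K = Set.ordConnectedComponent (Subtype.val ⁻¹' D) x}

/-- The set of realizations in `M` of a complete 1-type of `T`. -/
def locus {L : FirstOrder.Language.{u, v}} {T : L.Theory} (M : Type w) [L.Structure M] [Nonempty M]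
    [T.Model M] (q : T.CompleteType (Fin 1)) : Set M :=
  {x | T.typeOf (fun _ : Fin 1 => x) = q}

/-- Weak quasi-o-minimality: in every model of `T`, every parametrically definable set of elements
is a Boolean combination of parameter-free definable sets and convex sets. -/
def IsWeaklyQuasiOMinimal {L : FirstOrder.Language.{u, v}} (lt : L.Relations 2) (T : L.Theory) : Prop :=
  ∀ (M : Type w) [L.Structure M] [LinearOrder M] [Nonempty M] [T.Model M],
    InterpretsLT lt M →
    ∀ D : Set M, (Set.univ : Set M).Definable₁ L D →
      D ∈ BooleanSubalgebra.closure {S : Set M | IsUnaryDefinable L S ∨ S.OrdConnected}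

end LinearTheory

/-!
In a model of a theory with strong linear binarity, automorphisms can be cut off and glued at
initial parts. Gluing shows that if `f` fixes a tuple `a` and `x < y < f x`, where `y` is conjugate
to `x`, then some automorphism fixes `a` and takes `x` to `y`. It also shows that an initial part
preserved by all automorphisms fixing `a` is preserved by all automorphisms fixing a single entry of
`a`.

Elements with the same type are conjugate in an elementary extension, so by compactness both facts
become statements about finitely many formulas. By the first, for `D` defined over `a`, whether an
element belongs to `D` can change only finitely often along a set on which finitely many
parameter-free formulas have constant truth values; this gives the partition and the finiteness of
the number of components. By the second, a definable initial part is defined over one of its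
parameters `d`. Its conjugates have bounded height at each point, and the height of such an
initial part at a point yields a definable convex equivalence relation one of whose classes is a
final segment of it or, dually, if `d` lies outside, an initial segment of its complement.
-/

universe b

namespace LinearTheory

open FirstOrder FirstOrder.Language FirstOrder.Language.Structure
open scoped Pointwise

theorem exists_realize_of_forall_finset {L : FirstOrder.Language.{u, v}} {M : Type w}
    [L.Structure M] [Nonempty M] {β : Type b} {κ : Type*} (φ : κ → L.Formula β)
    (h : ∀ s : Finset κ, ∃ x : β → M, ∀ k ∈ s, (φ k).Realize x) :
    ∃ (N : Type (max u v b)) (_ : L.Structure N) (_ : Nonempty N),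
      (M ≅[L] N) ∧ ∃ x : β → N, ∀ k, (φ k).Realize x := by
  let S : Option κ → L[[β]].Theory := fun o => o.elim
    ((L.lhomWithConstants β).onTheory (L.completeTheory M)) fun k => {Formula.equivSentence (φ k)}
  have hS : Theory.IsSatisfiable (⋃ o, S o) := by
    rw [Theory.isSatisfiable_iUnion_iff_isSatisfiable_iUnion_finset]
    intro s
    obtain ⟨x, hx⟩ := h s.eraseNone
    let := constantsOn.structure x
    have : M ⊨ ⋃ o ∈ s, S o := by
      simp only [Theory.model_iff, Set.mem_iUnion]
      rintro ψ ⟨_ | k, ho, hψ⟩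
      · have : M ⊨ (L.lhomWithConstants β).onTheory (L.completeTheory M) :=
          (LHom.onTheory_model _ _).2 inferInstance
        exact this.realize_of_mem _ hψ
      · obtain rfl : ψ = Formula.equivSentence (φ k) := hψ
        rw [Formula.realize_equivSentence]
        exact hx k (Finset.mem_eraseNone.2 ho)
    exact Theory.Model.isSatisfiable M
  obtain ⟨N⟩ := hS
  let : L.Structure N := (L.lhomWithConstants β).reduct N
  have hN : ∀ o, ∀ ψ ∈ S o, (N : Type _) ⊨ ψ := fun o ψ hψ =>
    Theory.realize_sentence_of_mem (⋃ o, S o) (Set.mem_iUnion.2 ⟨o, hψ⟩)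
  refine ⟨N, inferInstance, inferInstance, ?_, fun a => (L.con a : N), fun k => ?_⟩
  · have : (N : Type _) ⊨ L.completeTheory M :=
      (LHom.onTheory_model (L.lhomWithConstants β) _).1
        ((Theory.model_iff _).2 (hN none))
    rw [elementarilyEquivalent_iff]
    exact fun ψ => (realize_iff_of_model_completeTheory M N ψ).symm
  · rw [← Formula.realize_equivSentence]
    exact hN (some k) _ rfl

theorem exists_formula_realize_iff_exists_extension {L : FirstOrder.Language.{u, v}} (M : Type w)
    [L.Structure M] [Nonempty M] {β : Type b} (φ : L.Formula β) (D : Set β) :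
    ∃ ψ : L.Formula D, ∀ y : D → M,
      ψ.Realize y ↔ ∃ x : β → M, (∀ d : D, x d = y d) ∧ φ.Realize x := by
  classical
  let F := φ.freeVarFinset
  let g : F → D ⊕ F := fun m => if h : (m : β) ∈ D then Sum.inl ⟨m, h⟩ else Sum.inr m
  have hg : ∀ (x : β → M) (y : D ⊕ F → M), (∀ m : F, y (g m) = x m) →
      (Formula.Realize (φ.restrictFreeVar g) y ↔ φ.Realize x) := fun x y hxy =>
    BoundedFormula.realize_restrictFreeVar x hxy
  refine ⟨Formula.iExs F (φ.restrictFreeVar g), fun y => ?_⟩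
  rw [Formula.realize_iExs]
  constructor
  · rintro ⟨z, hz⟩
    refine ⟨fun m => if h : m ∈ D then y ⟨m, h⟩ else if h : m ∈ F then z ⟨m, h⟩ else
      Classical.arbitrary M, fun d => dif_pos d.2, (hg _ _ fun m => ?_).1 hz⟩
    by_cases hm : (m : β) ∈ D <;> simp [g, hm]
  · rintro ⟨x, hxy, hx⟩
    refine ⟨fun m => x m, (hg x _ fun m => ?_).2 hx⟩
    by_cases hm : (m : β) ∈ D <;> simp [g, hm, ← hxy]

/-- A binary relation on `M` is elementary if matching tuples have the same type; for a functional
relation this says that it is a partial elementary map. -/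
def IsElementaryRel (L : FirstOrder.Language.{u, v}) {M : Type w} [L.Structure M]
    (R : Set (M × M)) : Prop :=
  ∀ (n : ℕ) (p : Fin n → M × M), (∀ k, p k ∈ R) → ∀ ψ : L.Formula (Fin n),
    ψ.Realize (fun k => (p k).1) ↔ ψ.Realize (fun k => (p k).2)

theorem isElementaryRel_range {L : FirstOrder.Language.{u, v}} {M : Type w} [L.Structure M]
    {J : Type*} {s t : J → M} (h : ∀ ψ : L.Formula J, ψ.Realize s ↔ ψ.Realize t) :
    IsElementaryRel L (Set.range fun j => (s j, t j)) := by
  intro n p hp ψ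
  choose f hf using hp
  have := h (ψ.relabel f)
  rw [Formula.realize_relabel, Formula.realize_relabel] at this
  simpa only [← hf, Function.comp_def] using this

namespace IsElementaryRel

variable {L : FirstOrder.Language.{u, v}} {M : Type w} [L.Structure M] {R : Set (M × M)}
variable (hR : IsElementaryRel L R)
include hR

theorem realize_iff {J : Type*} (p : J → M × M) (hp : ∀ j, p j ∈ R) (ψ : L.Formula J) :
    ψ.Realize (fun j => (p j).1) ↔ ψ.Realize (fun j => (p j).2) := by
  classical
  let e := Fintype.equivFin ψ.freeVarFinset
  have hrestrict : ∀ x : J → M, ψ.Realize x ↔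
      (Formula.relabel e (ψ.restrictFreeVar id : L.Formula ψ.freeVarFinset)).Realize
        (fun k => x (e.symm k)) := by
    intro x
    rw [Formula.realize_relabel]
    exact (BoundedFormula.realize_restrictFreeVar x fun a => by
      simp only [id_eq, Function.comp_apply, Equiv.symm_apply_apply]).symm
  rw [hrestrict, hrestrict]
  exact hR _ (fun k => p (e.symm k)) (fun k => hp _) _

theorem fst_eq_iff {a a' b b' : M} (h : (a, b) ∈ R) (h' : (a', b') ∈ R) : a = a' ↔ b = b' := by
  have := hR 2 ![(a, b), (a', b')] (Fin.forall_fin_two.2 ⟨h, h'⟩)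
    ((Term.var 0).equal (Term.var 1))
  simpa using this

theorem swap : IsElementaryRel L (Prod.swap ⁻¹' R) := fun n p hp ψ =>
  (hR n (fun k => (p k).swap) hp ψ).symm

theorem exists_realize_extending [Nonempty M] (s : Finset (L.Formula M))
    (hs : ∀ φ ∈ s, φ.Realize id) :
    ∃ x : M → M, (∀ φ ∈ s, φ.Realize x) ∧ ∀ r ∈ R, x r.1 = r.2 := by
  obtain ⟨ψ, hψ⟩ := exists_formula_realize_iff_exists_extension M
    (Formula.iInf fun φ : s => (φ : L.Formula M)) (Prod.fst '' R)
  choose r hrR hr using fun d : Prod.fst '' R => d.2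
  have hψ₁ : ψ.Realize fun d => (r d).1 := by
    rw [hψ]
    exact ⟨id, fun d => (hr d).symm, Formula.realize_iInf.2 fun φ => hs φ φ.2⟩
  rw [hR.realize_iff r hrR, hψ] at hψ₁
  obtain ⟨x, hx, hxs⟩ := hψ₁
  refine ⟨x, fun φ hφ => Formula.realize_iInf.1 hxs ⟨φ, hφ⟩, fun p hp => ?_⟩
  let d : Prod.fst '' R := ⟨p.1, p, hp, rfl⟩
  exact (hx d).trans ((hR.fst_eq_iff (hrR d) hp).1 (hr d))

theorem exists_equiv (hdom : ∀ x, ∃ y, (x, y) ∈ R) (hran : ∀ y, ∃ x, (x, y) ∈ R) :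
    ∃ σ : M ≃[L] M, ∀ r ∈ R, σ r.1 = r.2 := by
  choose f hf using hdom
  choose g hg using hran
  have hfψ : ∀ {n} (ψ : L.Formula (Fin n)) (x : Fin n → M), ψ.Realize (f ∘ x) ↔ ψ.Realize x :=
    fun ψ x => (hR _ (fun k => (x k, f (x k))) (fun k => hf _) ψ).symm
  refine ⟨⟨⟨f, g, fun x => ?_, fun y => ?_⟩, fun {n} F x => ?_, fun {n} r x => ?_⟩,
    fun r hr => ?_⟩
  · exact (hR.fst_eq_iff (hg _) (hf x)).2 rfl
  · exact (hR.fst_eq_iff (hf _) (hg y)).1 rfl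
  · have hgraph := (hfψ (Formula.graph F) (Fin.cons (funMap F x) x)).2 (Formula.realize_graph.2 rfl)
    rw [Fin.comp_cons, Formula.realize_graph] at hgraph
    exact hgraph.symm
  · exact hfψ (r.formula Term.var) x
  · exact (hR.fst_eq_iff (hf r.1) hr).1 rfl

end IsElementaryRel

theorem exists_elementaryEmbedding_of_realize {L : FirstOrder.Language.{u, v}} {M N : Type*}
    [L.Structure M] [L.Structure N] {x : M → N}
    (hx : ∀ φ : L.Formula M, φ.Realize id → φ.Realize x) : ∃ e : M ↪ₑ[L] N, ⇑e = x := by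
  refine ⟨⟨x, fun n ψ z => ⟨fun h => ?_, fun h => ?_⟩⟩, rfl⟩
  · by_contra hn
    have := hx (ψ.relabel z).not (by rwa [Formula.realize_not, Formula.realize_relabel])
    rw [Formula.realize_not, Formula.realize_relabel] at this
    exact this h
  · have := hx (ψ.relabel z) (by rwa [Formula.realize_relabel])
    rwa [Formula.realize_relabel] at this

theorem exists_elementaryEmbeddings_extending {L : FirstOrder.Language.{u, v}} {M : Type (max u v)}
    [L.Structure M] [Nonempty M] {ι : Type} {R : ι → Set (M × M)}
    (hR : ∀ i, IsElementaryRel L (R i)) :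
    ∃ (N : Type (max u v)) (_ : L.Structure N) (_ : Nonempty N) (e : M ↪ₑ[L] N)
      (f : ι → M ↪ₑ[L] N), ∀ i, ∀ r ∈ R i, f i r.1 = e r.2 := by
  classical
  let Φ := {φ : L.Formula M // φ.Realize id}
  let γ : (Option ι × Φ) ⊕ (Σ i, R i) → L.Formula (Option ι × M) :=
    Sum.elim (fun k => k.2.1.relabel (Prod.mk k.1))
      fun r => (Term.var (some r.1, r.2.1.1)).equal (Term.var (none, r.2.1.2))
  obtain ⟨N, _, _, -, x, hx⟩ := exists_realize_of_forall_finset (M := M) γ (by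
    intro s
    choose x hxs hxR using fun i => (hR i).exists_realize_extending
      (s.toLeft.image fun k => k.2.1) (by
        simp only [Finset.mem_image]
        rintro _ ⟨k, -, rfl⟩
        exact k.2.2)
    refine ⟨fun p => p.1.elim id x p.2, ?_⟩
    rintro (⟨_ | i, φ⟩ | r) hk
    · exact Formula.realize_relabel.2 φ.2
    · exact Formula.realize_relabel.2
        (hxs i φ (Finset.mem_image_of_mem (fun k => k.2.1) (Finset.mem_toLeft.2 hk)))
    · exact Formula.realize_equal.2 (hxR r.1 _ r.2.2))
  choose f hf using fun o => exists_elementaryEmbedding_of_realize (x := fun m => x (o, m))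
    fun φ hφ => Formula.realize_relabel.1 (hx (Sum.inl (o, ⟨φ, hφ⟩)))
  refine ⟨N, inferInstance, inferInstance, f none, fun i => f (some i), fun i r hr => ?_⟩
  rw [hf, hf]
  exact Formula.realize_equal.1 (hx (Sum.inr ⟨i, r, hr⟩))

section DirectLimit

variable {L : FirstOrder.Language.{u, v}} {ι : Type b} [Preorder ι] [IsDirectedOrder ι] [Nonempty ι]
  {G : ι → Type w} [∀ i, L.Structure (G i)] (f : ∀ i j, i ≤ j → G i ↪ₑ[L] G j)
  [DirectedSystem G fun i j h => (f i j h).toEmbedding]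

theorem realize_directLimit_of {α : Type*} {n : ℕ} (φ : L.BoundedFormula α n) (i : ι)
    (x : α → G i) (y : Fin n → G i) :
    φ.Realize (DirectLimit.of L ι G (fun i j h => (f i j h).toEmbedding) i ∘ x)
      (DirectLimit.of L ι G (fun i j h => (f i j h).toEmbedding) i ∘ y) ↔ φ.Realize x y := by
  induction φ generalizing i with
  | falsum => exact Iff.rfl
  | equal t₁ t₂ =>
    simp only [BoundedFormula.Realize, ← Sum.comp_elim, HomClass.realize_term]
    exact (DirectLimit.of L ι G _ i).injective.eq_iff
  | rel R ts =>
    simp only [BoundedFormula.Realize, ← Sum.comp_elim, HomClass.realize_term]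
    exact (DirectLimit.of L ι G _ i).map_rel R _
  | imp φ ψ hφ hψ =>
    rw [BoundedFormula.realize_imp, BoundedFormula.realize_imp, hφ, hψ]
  | all φ ih =>
    rw [BoundedFormula.realize_all, BoundedFormula.realize_all]
    constructor
    · intro h a
      rw [← ih, Fin.comp_snoc]
      exact h _
    · intro h a
      obtain ⟨j, c, rfl⟩ := DirectLimit.exists_of a
      obtain ⟨k, hik, hjk⟩ := directed_of (· ≤ ·) i j
      have hk : φ.all.Realize (f i k hik ∘ x) (f i k hik ∘ y) :=
        ((f i k hik).map_boundedFormula φ.all x y).2 h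
      have hof : DirectLimit.of L ι G (fun i j h => (f i j h).toEmbedding) k ∘ f i k hik =
          DirectLimit.of L ι G (fun i j h => (f i j h).toEmbedding) i :=
        funext fun z => DirectLimit.of_f (hij := hik) (x := z)
      have := (ih k _ _).2 (hk (f j k hjk c))
      rw [Fin.comp_snoc, ← Function.comp_assoc, ← Function.comp_assoc, hof] at this
      rwa [← DirectLimit.of_f (hij := hjk) (x := c)]

/-- The canonical map into the direct limit of a system of elementary embeddings, as an elementary
embedding. -/
noncomputable def directLimitOf (i : ι) :
    G i ↪ₑ[L] Language.DirectLimit G fun i j h => (f i j h).toEmbedding where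
  toFun := DirectLimit.of L ι G (fun i j h => (f i j h).toEmbedding) i
  map_formula' n φ x := by
    have := realize_directLimit_of f φ i x default
    rwa [Unique.eq_default (_ ∘ default)] at this

end DirectLimit

/-- An `L`-structure with a family of elementary relations, the finite stages of the construction
of automorphisms extending these relations. -/
structure ElementaryStage (L : FirstOrder.Language.{u, v}) (ι : Type) where
  carrier : Type (max u v)
  [str : L.Structure carrier]
  [nonempty : Nonempty carrier]
  rel : ι → Set (carrier × carrier)
  elementary : ∀ i, IsElementaryRel L (rel i)

namespace ElementaryStage

attribute [instance] ElementaryStage.str ElementaryStage.nonempty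

variable {L : FirstOrder.Language.{u, v}} {ι : Type} (S : ElementaryStage L ι)

/-- The stage with all relations reversed, exchanging total and surjective relations. -/
def swap : ElementaryStage L ι where
  carrier := S.carrier
  rel i := Prod.swap ⁻¹' S.rel i
  elementary i := (S.elementary i).swap

theorem exists_total :
    ∃ (S' : ElementaryStage L ι) (e : S.carrier ↪ₑ[L] S'.carrier),
      (∀ i x y, (x, y) ∈ S.rel i → (e x, e y) ∈ S'.rel i) ∧ ∀ i x, ∃ y, (e x, y) ∈ S'.rel i := by
  obtain ⟨N, _, _, e, f, hf⟩ := exists_elementaryEmbeddings_extending S.elementary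
  refine ⟨⟨N, fun i => Set.range fun x => (e x, f i x), fun i => isElementaryRel_range
    fun ψ => ?_⟩, e, fun i x y h => ⟨x, ?_⟩, fun i x => ⟨f i x, x, rfl⟩⟩
  · exact (e.map_formula ψ id).trans ((f i).map_formula ψ id).symm
  · simp only [hf i _ h]

theorem exists_total_surjective :
    ∃ (S' : ElementaryStage L ι) (e : S.carrier ↪ₑ[L] S'.carrier),
      (∀ i x y, (x, y) ∈ S.rel i → (e x, e y) ∈ S'.rel i) ∧
      ∀ i x, (∃ y, (e x, y) ∈ S'.rel i) ∧ ∃ y, (y, e x) ∈ S'.rel i := by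
  obtain ⟨S₁, e₁, h₁, t₁⟩ := S.exists_total
  obtain ⟨S₂, e₂, h₂, t₂⟩ := S₁.swap.exists_total
  refine ⟨S₂.swap, e₂.comp e₁, fun i x y h => h₂ i _ _ (h₁ i _ _ h), fun i x => ⟨?_, ?_⟩⟩
  · obtain ⟨y, hy⟩ := t₁ i x
    exact ⟨e₂ y, h₂ i y (e₁ x) hy⟩
  · exact t₂ i (e₁ x)

/-- A chosen extension of `S` in which all relations are total and surjective on `S`. -/
noncomputable def next : ElementaryStage L ι :=
  S.exists_total_surjective.choose

/-- The chain of iterated extensions of a stage. -/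
noncomputable def chain : ℕ → ElementaryStage L ι
  | 0 => S
  | n + 1 => (chain n).next

/-- The inclusion of a stage of the chain in the next one. -/
noncomputable def chainStep (n : ℕ) : (S.chain n).carrier ↪ₑ[L] (S.chain (n + 1)).carrier :=
  (S.chain n).exists_total_surjective.choose_spec.choose

theorem chainStep_mem_rel {n : ℕ} {i : ι} {x y : (S.chain n).carrier}
    (h : (x, y) ∈ (S.chain n).rel i) :
    (S.chainStep n x, S.chainStep n y) ∈ (S.chain (n + 1)).rel i :=
  (S.chain n).exists_total_surjective.choose_spec.choose_spec.1 i x y h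

theorem exists_chainStep_left_mem_rel (n : ℕ) (i : ι) (x : (S.chain n).carrier) :
    ∃ y, (S.chainStep n x, y) ∈ (S.chain (n + 1)).rel i :=
  ((S.chain n).exists_total_surjective.choose_spec.choose_spec.2 i x).1

theorem exists_chainStep_right_mem_rel (n : ℕ) (i : ι) (x : (S.chain n).carrier) :
    ∃ y, (y, S.chainStep n x) ∈ (S.chain (n + 1)).rel i :=
  ((S.chain n).exists_total_surjective.choose_spec.choose_spec.2 i x).2

/-- The transition maps of the chain of iterated extensions. -/
noncomputable def chainMap (m n : ℕ) (h : m ≤ n) : (S.chain m).carrier ↪ₑ[L] (S.chain n).carrier :=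
  Nat.leRecOn (C := fun k => (S.chain m).carrier ↪ₑ[L] (S.chain k).carrier) h
    (fun {k} e => (S.chainStep k).comp e) (ElementaryEmbedding.refl L _)

theorem chainMap_self (m : ℕ) (x : (S.chain m).carrier) : S.chainMap m m le_rfl x = x := by
  rw [chainMap, Nat.leRecOn_self, ElementaryEmbedding.refl_apply]

theorem chainMap_succ {m n : ℕ} (h : m ≤ n) (x : (S.chain m).carrier) :
    S.chainMap m (n + 1) (h.trans n.le_succ) x = S.chainStep n (S.chainMap m n h x) := by
  rw [chainMap, Nat.leRecOn_succ h, ElementaryEmbedding.comp_apply, chainMap]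

instance : DirectedSystem (fun n => (S.chain n).carrier) fun m n h =>
    (S.chainMap m n h).toEmbedding where
  map_self m x := S.chainMap_self m x
  map_map k j i hij hjk x := by
    induction k, hjk using Nat.le_induction with
    | base => exact S.chainMap_self j _
    | succ k hjk ih =>
      exact (S.chainMap_succ hjk _).trans
        ((congrArg (S.chainStep k) ih).trans (S.chainMap_succ (hij.trans hjk) x).symm)

theorem chainMap_mem_rel {m n : ℕ} (h : m ≤ n) {i : ι} {x y : (S.chain m).carrier}
    (hxy : (x, y) ∈ (S.chain m).rel i) :
    (S.chainMap m n h x, S.chainMap m n h y) ∈ (S.chain n).rel i := by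
  induction n, h using Nat.le_induction with
  | base => rwa [chainMap_self, chainMap_self]
  | succ n h ih =>
    rw [S.chainMap_succ h, S.chainMap_succ h]
    exact S.chainStep_mem_rel ih

/-- The union of the chain of iterated extensions. -/
def limit : Type (max u v) :=
  Language.DirectLimit (fun n => (S.chain n).carrier) fun m n h => (S.chainMap m n h).toEmbedding

noncomputable instance : L.Structure S.limit :=
  inferInstanceAs (L.Structure (Language.DirectLimit _ _))

/-- The inclusion of a stage of the chain in its union. -/
noncomputable def toLimit (n : ℕ) : (S.chain n).carrier ↪ₑ[L] S.limit :=
  directLimitOf S.chainMap n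

theorem toLimit_chainMap {m n : ℕ} (h : m ≤ n) (x : (S.chain m).carrier) :
    S.toLimit n (S.chainMap m n h x) = S.toLimit m x :=
  DirectLimit.of_f

theorem toLimit_chainStep (n : ℕ) (x : (S.chain n).carrier) :
    S.toLimit (n + 1) (S.chainStep n x) = S.toLimit n x := by
  rw [← S.toLimit_chainMap n.le_succ, S.chainMap_succ le_rfl, chainMap_self]

theorem exists_toLimit_eq (x : S.limit) : ∃ n y, S.toLimit n y = x :=
  DirectLimit.exists_of x

/-- The union of the `i`-th relations of the stages of the chain. -/
def limitRel (i : ι) : Set (S.limit × S.limit) :=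
  ⋃ n, Prod.map (S.toLimit n) (S.toLimit n) '' (S.chain n).rel i

theorem isElementaryRel_limitRel (i : ι) : IsElementaryRel L (S.limitRel i) := by
  intro k p hp ψ
  choose n r hr hrp using fun j => Set.mem_iUnion.1 (hp j)
  obtain ⟨m, hm⟩ := Finite.bddAbove_range n
  have hnm : ∀ j, n j ≤ m := fun j => hm ⟨j, rfl⟩
  have := (S.chain m).elementary i k (fun j => (S.chainMap _ m (hnm j) (r j).1,
    S.chainMap _ m (hnm j) (r j).2)) (fun j => S.chainMap_mem_rel (hnm j) (hr j)) ψ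
  rw [← (S.toLimit m).map_formula, ← (S.toLimit m).map_formula] at this
  simpa only [← hrp, Function.comp_def, toLimit_chainMap, Prod.map_fst, Prod.map_snd] using this

theorem exists_left_mem_limitRel (i : ι) (x : S.limit) : ∃ y, (x, y) ∈ S.limitRel i := by
  obtain ⟨n, x, rfl⟩ := S.exists_toLimit_eq x
  obtain ⟨y, hy⟩ := S.exists_chainStep_left_mem_rel n i x
  refine ⟨S.toLimit (n + 1) y, Set.mem_iUnion.2 ⟨n + 1, _, hy, ?_⟩⟩
  rw [Prod.map_apply, toLimit_chainStep]

theorem exists_right_mem_limitRel (i : ι) (y : S.limit) : ∃ x, (x, y) ∈ S.limitRel i := by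
  obtain ⟨n, y, rfl⟩ := S.exists_toLimit_eq y
  obtain ⟨x, hx⟩ := S.exists_chainStep_right_mem_rel n i y
  refine ⟨S.toLimit (n + 1) x, Set.mem_iUnion.2 ⟨n + 1, _, hx, ?_⟩⟩
  rw [Prod.map_apply, toLimit_chainStep]

end ElementaryStage

theorem exists_equiv_extending {L : FirstOrder.Language.{u, v}} {M : Type (max u v)}
    [L.Structure M] [Nonempty M] {ι : Type} {R : ι → Set (M × M)}
    (hR : ∀ i, IsElementaryRel L (R i)) :
    ∃ (N : Type (max u v)) (_ : L.Structure N) (e : M ↪ₑ[L] N) (σ : ι → N ≃[L] N),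
      ∀ i, ∀ r ∈ R i, σ i (e r.1) = e r.2 := by
  let S : ElementaryStage L ι := ⟨M, R, hR⟩
  choose σ hσ using fun i => (S.isElementaryRel_limitRel i).exists_equiv
    (S.exists_left_mem_limitRel i) (S.exists_right_mem_limitRel i)
  exact ⟨S.limit, inferInstance, S.toLimit 0, σ, fun i r hr =>
    hσ i _ (Set.mem_iUnion.2 ⟨0, r, hr, rfl⟩)⟩

theorem exists_finset_forall_realize_of_conjugate {L : FirstOrder.Language.{u, v}} {M : Type w}
    [L.Structure M] [Nonempty M] {β ι : Type} {J : Type*} (φ : L.Formula β) (s t : ι → J → β)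
    (h : ∀ (N : Type (max u v)) [L.Structure N] [Nonempty N], (M ≅[L] N) →
      ∀ (x : β → N) (σ : ι → N ≃[L] N), (∀ i j, σ i (x (s i j)) = x (t i j)) → φ.Realize x) :
    ∃ Θ : Finset (L.Formula J), ∀ x : β → M,
      (∀ i, ∀ θ ∈ Θ, θ.Realize (x ∘ s i) ↔ θ.Realize (x ∘ t i)) → φ.Realize x := by
  classical
  by_contra! hcon
  let γ : Option (ι × L.Formula J) → L.Formula β := fun o =>
    o.elim φ.not fun k => (k.2.relabel (s k.1)).iff (k.2.relabel (t k.1))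
  obtain ⟨N, _, _, hMN, x, hx⟩ := exists_realize_of_forall_finset (M := M) γ (by
    intro Γ
    obtain ⟨x, hxΘ, hx⟩ := hcon (Γ.eraseNone.image Prod.snd)
    refine ⟨x, ?_⟩
    rintro (_ | ⟨i, θ⟩) hk
    · exact hx
    · simpa only [γ, Option.elim_some, Formula.realize_iff, Formula.realize_relabel] using
        hxΘ i θ (Finset.mem_image_of_mem Prod.snd (Finset.mem_eraseNone.2 hk)))
  obtain ⟨N', _, e, σ, hσ⟩ := exists_equiv_extending fun i =>
    isElementaryRel_range (s := x ∘ s i) (t := x ∘ t i) fun ψ => by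
      simpa only [γ, Option.elim_some, Formula.realize_iff, Formula.realize_relabel] using
        hx (some (i, ψ))
  have hNN' := e.elementarilyEquivalent
  have := hNN'.nonempty
  refine hx none ((e.map_formula φ x).1 (h N' (hMN.trans hNN') (e ∘ x) σ fun i j => ?_))
  exact hσ i _ ⟨j, rfl⟩

/-- An action of a group on a linear order by order automorphisms such that every element which
preserves an initial part can be replaced by the identity off that part. -/
structure IsGlueClosed (G α : Type*) [Group G] [LinearOrder α] [MulAction G α] : Prop where
  strictMono_smul : ∀ g : G, StrictMono fun x : α => g • x
  exists_eq_on : ∀ C : Set α, IsLowerSet C → ∀ g : G, (∀ x, g • x ∈ C ↔ x ∈ C) →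
    ∃ h : G, (∀ x ∈ C, h • x = g • x) ∧ ∀ x ∉ C, h • x = x

section Gluing

open MulAction

variable {G α : Type*} [Group G] [LinearOrder α] [MulAction G α]

/-- The initial part of `α` generated by the forward orbit of `x` under `u`. -/
def orbitHull (u : G) (x : α) : Set α :=
  {y | ∃ n : ℕ, y ≤ u ^ n • x}

theorem isLowerSet_orbitHull (u : G) (x : α) : IsLowerSet (orbitHull u x) :=
  fun _ _ hle ⟨n, hn⟩ => ⟨n, hle.trans hn⟩

theorem mem_orbitHull_self (u : G) (x : α) : x ∈ orbitHull u x :=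
  ⟨0, by rw [pow_zero, one_smul]⟩

theorem orbitHull_subset {u : G} {x : α} {D : Set α} (hD : IsLowerSet D) (hx : x ∈ D)
    (hu : ∀ y ∈ D, u • y ∈ D) : orbitHull u x ⊆ D := by
  have hpow : ∀ n : ℕ, u ^ n • x ∈ D := by
    intro n
    induction n with
    | zero => rwa [pow_zero, one_smul]
    | succ n ih => rw [pow_succ', mul_smul]; exact hu _ ih
  rintro y ⟨n, hn⟩
  exact hD hn (hpow n)

namespace IsGlueClosed

variable (hG : IsGlueClosed G α)
include hG

theorem smul_lt_iff (g : G) {x y : α} : g • x < g • y ↔ x < y :=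
  (hG.strictMono_smul g).lt_iff_lt

theorem smul_le_iff (g : G) {x y : α} : g • x ≤ g • y ↔ x ≤ y :=
  (hG.strictMono_smul g).le_iff_le

theorem exists_eq_off {C : Set α} (hC : IsLowerSet C) {g : G} (hg : ∀ x, g • x ∈ C ↔ x ∈ C) :
    ∃ h : G, (∀ x ∈ C, h • x = x) ∧ ∀ x ∉ C, h • x = g • x := by
  obtain ⟨h, h_on, h_off⟩ := hG.exists_eq_on C hC g hg
  refine ⟨h⁻¹ * g, fun x hx => ?_, fun x hx => ?_⟩
  · rw [mul_smul, inv_smul_eq_iff, h_on x hx]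
  · rw [mul_smul, inv_smul_eq_iff, h_off _ (mt (hg x).1 hx)]

theorem dual : IsGlueClosed G αᵒᵈ where
  strictMono_smul g := (hG.strictMono_smul g).dual
  exists_eq_on C hC g hg := by
    obtain ⟨h, h_on, h_off⟩ := hG.exists_eq_off (C := OrderDual.toDual ⁻¹' Cᶜ) hC.compl.toDual
      (g := g) fun x => not_congr (hg (OrderDual.toDual x))
    exact ⟨h, fun x hx => h_off (OrderDual.ofDual x) (not_not_intro hx),
      fun x hx => h_on (OrderDual.ofDual x) hx⟩

theorem smul_mem_Iic_iff {g : G} {x : α} (hg : g • x = x) (y : α) :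
    g • y ∈ Set.Iic x ↔ y ∈ Set.Iic x := by
  have := hG.smul_le_iff g (x := y) (y := x)
  rwa [hg] at this

theorem exists_eq_on_Iic {g : G} {x : α} (hg : g • x = x) :
    ∃ h : G, (∀ y ≤ x, h • y = g • y) ∧ ∀ y, x < y → h • y = y := by
  obtain ⟨h, h_on, h_off⟩ := hG.exists_eq_on _ (isLowerSet_Iic x) g (hG.smul_mem_Iic_iff hg)
  exact ⟨h, h_on, fun y hy => h_off y hy.not_ge⟩

theorem exists_eq_on_Ici {g : G} {x : α} (hg : g • x = x) :
    ∃ h : G, (∀ y, x ≤ y → h • y = g • y) ∧ ∀ y < x, h • y = y :=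
  hG.dual.exists_eq_on_Iic (x := OrderDual.toDual x) hg

theorem exists_eq_on_Ioi {g : G} {x : α} (hg : g • x = x) :
    ∃ h : G, (∀ y ≤ x, h • y = y) ∧ ∀ y, x < y → h • y = g • y := by
  obtain ⟨h, h_on, h_off⟩ := hG.exists_eq_off (isLowerSet_Iic x) (hG.smul_mem_Iic_iff hg)
  exact ⟨h, h_on, fun y hy => h_off y hy.not_ge⟩

theorem smul_mem_orbitHull_iff {u : G} {x : α} (hx : x ≤ u • x) (y : α) :
    u • y ∈ orbitHull u x ↔ y ∈ orbitHull u x := by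
  constructor <;> rintro ⟨n, hn⟩
  · have hstep : u ^ n • x ≤ u • u ^ n • x := by
      rw [← mul_smul, ← pow_succ', pow_succ, mul_smul]
      exact (hG.smul_le_iff _).2 hx
    exact ⟨n, (hG.smul_le_iff u).1 (hn.trans hstep)⟩
  · exact ⟨n + 1, by rw [pow_succ', mul_smul]; exact (hG.smul_le_iff u).2 hn⟩

theorem le_of_mem_orbitHull {u : G} {x a : α} (ha : a ∈ orbitHull u x) (hu : u • a = a) :
    a ≤ x := by
  obtain ⟨n, hn⟩ := ha
  have hpow : u ^ n • a = a := (stabilizer G a).pow_mem hu n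
  exact (hG.smul_le_iff (u ^ n)).1 (hpow.symm ▸ hn)

/-- Whichever of the two elements `g` and `g⁻¹ * f` maps the initial part generated by the
`f`-orbit of `x` into itself is cut off at the initial part generated by its own orbit. -/
theorem exists_smul_eq_fixing_above {f g : G} {x : α} (hxg : x ≤ g • x) (hgf : g • x ≤ f • x) :
    ∃ k : G, k • x = g • x ∧ ∀ a, x ≤ a → f • a = a → k • a = a := by
  have hf := hG.smul_mem_orbitHull_iff (hxg.trans hgf)
  have hfix : ∀ a ∈ orbitHull f x, x ≤ a → f • a = a → a = x ∧ g • x = x :=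
    fun a ha hxa hfa => by
      obtain rfl := (hG.le_of_mem_orbitHull ha hfa).antisymm hxa
      exact ⟨rfl, (hgf.trans hfa.le).antisymm hxg⟩
  have hlower : IsLowerSet {y : α | g • y ∈ orbitHull f x} := fun _ _ hle hy =>
    isLowerSet_orbitHull f x ((hG.smul_le_iff g).2 hle) hy
  rcases (isLowerSet_orbitHull f x).total hlower with hg | hg
  · have hsub := orbitHull_subset (isLowerSet_orbitHull f x) (mem_orbitHull_self f x) hg
    obtain ⟨k, k_on, k_off⟩ := hG.exists_eq_on _ (isLowerSet_orbitHull g x) g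
      (hG.smul_mem_orbitHull_iff hxg)
    have hkx := k_on x (mem_orbitHull_self g x)
    refine ⟨k, hkx, fun a hxa hfa => ?_⟩
    by_cases ha : a ∈ orbitHull g x
    · obtain ⟨rfl, hga⟩ := hfix a (hsub ha) hxa hfa
      exact hkx.trans hga
    · exact k_off a ha
  · let u := g⁻¹ * f
    have hxu : x ≤ u • x := by
      rw [← hG.smul_le_iff g, mul_smul, smul_inv_smul]
      exact hgf
    have hsub : orbitHull u x ⊆ orbitHull f x :=
      orbitHull_subset (isLowerSet_orbitHull f x) (mem_orbitHull_self f x) fun y hy =>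
        hg (by rw [Set.mem_ofPred_eq, mul_smul, smul_inv_smul]; exact (hf y).2 hy)
    obtain ⟨v, v_on, v_off⟩ := hG.exists_eq_on _ (isLowerSet_orbitHull u x) u⁻¹ fun y => by
      rw [← hG.smul_mem_orbitHull_iff hxu, smul_inv_smul]
    have hkx : (f * v) • x = g • x := by
      rw [mul_smul, v_on x (mem_orbitHull_self u x), ← mul_smul]
      simp only [u, mul_inv_rev, inv_inv, mul_inv_cancel_left]
    refine ⟨f * v, hkx, fun a hxa hfa => ?_⟩
    by_cases ha : a ∈ orbitHull u x
    · obtain ⟨rfl, hga⟩ := hfix a (hsub ha) hxa hfa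
      exact hkx.trans hga
    · rw [mul_smul, v_off a ha, hfa]

theorem exists_smul_eq_fixing_below {f g : G} {x : α} (hxg : x ≤ g • x) (hgf : g • x ≤ f • x) :
    ∃ k : G, k • x = g • x ∧ ∀ a ≤ x, f • a = a → k • a = a := by
  have hfx : f⁻¹ • f • x = x := inv_smul_smul f x
  have hgx : (g * f⁻¹) • f • x = g • x := by rw [mul_smul, hfx]
  obtain ⟨k, hk, hk_fix⟩ := hG.dual.exists_smul_eq_fixing_above (f := f⁻¹) (g := g * f⁻¹)
    (x := OrderDual.toDual (f • x)) (hgx.trans_le hgf) ((hfx.trans_le hxg).trans_eq hgx.symm)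
  refine ⟨k * f, ?_, fun a hax hfa => ?_⟩
  · rw [mul_smul]
    exact hk.trans hgx
  · rw [mul_smul, hfa]
    exact hk_fix (OrderDual.toDual a) (hfa.ge.trans ((hG.smul_le_iff f).2 hax))
      (inv_smul_eq_iff.2 hfa.symm)

theorem exists_eq_above_fixing_below {f g : G} {x : α} (hxg : x ≤ g • x) (hgf : g • x ≤ f • x) :
    ∃ k : G, (∀ a ≤ x, f • a = a → k • a = a) ∧ ∀ y, x ≤ y → k • y = g • y := by
  obtain ⟨k, hkx, hk_fix⟩ := hG.exists_smul_eq_fixing_below hxg hgf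
  obtain ⟨w, w_below, w_above⟩ := hG.exists_eq_on_Ioi (g := k⁻¹ * g) (x := x)
    (by rw [mul_smul, inv_smul_eq_iff, hkx])
  refine ⟨k * w, fun a hax hfa => ?_, fun y hxy => ?_⟩
  · rw [mul_smul, w_below a hax, hk_fix a hax hfa]
  · rw [mul_smul]
    rcases hxy.eq_or_lt with rfl | hxy
    · rw [w_below x le_rfl, hkx]
    · rw [w_above y hxy, mul_smul, smul_inv_smul]

theorem exists_smul_eq_fixing {f g : G} {x : α} (hxg : x ≤ g • x) (hgf : g • x ≤ f • x) :
    ∃ k : G, k • x = g • x ∧ ∀ a : α, f • a = a → k • a = a := by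
  obtain ⟨k₁, hk₁x, hk₁⟩ := hG.exists_smul_eq_fixing_above hxg hgf
  obtain ⟨k, k_below, k_above⟩ := hG.exists_eq_above_fixing_below (f := f) (g := k₁) (x := x)
    (by rwa [hk₁x]) (by rwa [hk₁x])
  refine ⟨k, (k_above x le_rfl).trans hk₁x, fun a hfa => ?_⟩
  rcases le_total a x with hax | hxa
  · exact k_below a hax hfa
  · rw [k_above a hxa, hk₁ a hxa hfa]

theorem fixingSubgroup_le_stabilizer_or_exists_le {I A₁ A₂ : Set α} (hA₁ : A₁ ⊆ I)
    (h : fixingSubgroup G (A₁ ∪ A₂) ≤ stabilizer G I) :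
    fixingSubgroup G A₁ ≤ stabilizer G I ∨
      ∃ f ∈ fixingSubgroup G A₁, ∃ p ∈ I, ∃ b ∈ A₂, b ≤ f • p := by
  rw [or_iff_not_imp_right]
  intro hfar f hf
  let C : Set α := {y | ∃ f ∈ fixingSubgroup G A₁, ∃ p ∈ I, y ≤ f • p}
  have hC : IsLowerSet C := fun _ _ hle ⟨f, hf, p, hp, hy⟩ => ⟨f, hf, p, hp, hle.trans hy⟩
  have hIC : I ⊆ C := fun p hp => ⟨1, one_mem _, p, hp, by rw [one_smul]⟩
  have hmaps : ∀ k ∈ fixingSubgroup G A₁, ∀ y ∈ C, k • y ∈ C := fun k hk y ⟨f, hf, p, hp, hy⟩ =>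
    ⟨k * f, mul_mem hk hf, p, hp, by rw [mul_smul]; exact (hG.smul_le_iff k).2 hy⟩
  have hfC : ∀ y, f • y ∈ C ↔ y ∈ C := fun y =>
    ⟨fun hy => by simpa using hmaps f⁻¹ (inv_mem hf) _ hy, hmaps f hf y⟩
  obtain ⟨k, k_on, k_off⟩ := hG.exists_eq_on C hC f hfC
  have hkI : ∀ y, k • y ∈ I ↔ y ∈ I := by
    refine mem_stabilizer_set.1 (h ((mem_fixingSubgroup_iff G).2 ?_))
    rintro a (ha | ha)
    · rw [k_on a (hIC (hA₁ ha)), (mem_fixingSubgroup_iff G).1 hf a ha]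
    · exact k_off a fun ⟨f, hf, p, hp, hle⟩ => hfar ⟨f, hf, p, hp, a, ha, hle⟩
  refine mem_stabilizer_set.2 fun y => ?_
  by_cases hy : y ∈ C
  · rw [← k_on y hy, hkI]
  · exact iff_of_false (fun h => hy ((hfC y).1 (hIC h))) fun h => hy (hIC h)

theorem fixingSubgroup_le_stabilizer_or_exists_ge {I A₁ A₂ : Set α} (hA₂ : A₂ ⊆ Iᶜ)
    (h : fixingSubgroup G (A₁ ∪ A₂) ≤ stabilizer G I) :
    fixingSubgroup G A₂ ≤ stabilizer G I ∨
      ∃ f ∈ fixingSubgroup G A₂, ∃ p ∉ I, ∃ a ∈ A₁, f • p ≤ a := by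
  rw [Set.union_comm] at h
  have hdual := hG.dual.fixingSubgroup_le_stabilizer_or_exists_le (I := OrderDual.ofDual ⁻¹' Iᶜ)
    (A₁ := OrderDual.ofDual ⁻¹' A₂) (A₂ := OrderDual.ofDual ⁻¹' A₁) hA₂
    (h.trans (stabilizer_compl G α).ge)
  exact hdual.imp_left fun h' => h'.trans (stabilizer_compl G α).le

theorem fixingSubgroup_le_stabilizer_or {I A₁ A₂ : Set α} (hI : IsLowerSet I)
    (hA₁ : A₁ ⊆ I) (hA₂ : A₂ ⊆ Iᶜ) (h : fixingSubgroup G (A₁ ∪ A₂) ≤ stabilizer G I) :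
    fixingSubgroup G A₁ ≤ stabilizer G I ∨
      fixingSubgroup G A₂ ≤ stabilizer G I := by
  by_contra! hcon
  obtain ⟨f, hf, p, hp, b, hb, hbp⟩ :=
    (hG.fixingSubgroup_le_stabilizer_or_exists_le hA₁ h).resolve_left hcon.1
  obtain ⟨g, hg, q, hq, a, ha, haq⟩ :=
    (hG.fixingSubgroup_le_stabilizer_or_exists_ge hA₂ h).resolve_left hcon.2
  rw [mem_fixingSubgroup_iff] at hf
  have hA₁p : ∀ a ∈ A₁, a ≤ p := by
    refine fun a ha => not_lt.1 fun hpa => hA₂ hb (hI ?_ (hA₁ ha))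
    exact hbp.trans ((hf a ha) ▸ ((hG.smul_lt_iff f).2 hpa).le)
  have hqp : q ≤ g⁻¹ • p := by
    rw [← hG.smul_le_iff g, smul_inv_smul]
    exact haq.trans (hA₁p a ha)
  have hgp : g⁻¹ • p ∉ I := fun h => hq (hI hqp h)
  have hA₂p : ∀ b ∈ A₂, p ≤ b := fun b hb => not_lt.1 fun hlt => hA₂ hb (hI hlt.le hp)
  have hg' := (mem_fixingSubgroup_iff G).1 (inv_mem hg)
  obtain ⟨k, k_below, k_above⟩ := hG.exists_eq_above_fixing_below (f := f) (g := g⁻¹) (x := p)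
    (not_lt.1 fun hlt => hgp (hI hlt.le hp))
    (((hG.smul_le_iff g⁻¹).2 (hA₂p b hb)).trans_eq (hg' b hb) |>.trans hbp)
  have hk : k ∈ fixingSubgroup G (A₁ ∪ A₂) := by
    rw [mem_fixingSubgroup_iff]
    rintro a (ha | ha)
    · exact k_below a (hA₁p a ha) (hf a ha)
    · rw [k_above a (hA₂p a ha), hg' a ha]
  refine hgp ?_
  rw [← k_above p le_rfl, mem_stabilizer_set.1 (h hk)]
  exact hp

theorem stabilizer_le_of_isGreatest {I A : Set α} {a : α} (hI : IsLowerSet I) (hA : A ⊆ I)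
    (ha : IsGreatest A a) (h : fixingSubgroup G A ≤ stabilizer G I) :
    stabilizer G a ≤ stabilizer G I := by
  intro f hf
  obtain ⟨k, k_below, k_above⟩ := hG.exists_eq_on_Ioi hf
  have hk : k ∈ fixingSubgroup G A :=
    (mem_fixingSubgroup_iff G).2 fun b hb => k_below b (ha.2 hb)
  refine mem_stabilizer_set.2 fun y => ?_
  rcases le_or_gt y a with hya | hay
  · exact iff_of_true (hI ((hG.smul_mem_Iic_iff hf y).2 hya) (hA ha.1)) (hI hya (hA ha.1))
  · rw [← k_above y hay, mem_stabilizer_set.1 (h hk)]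

theorem exists_stabilizer_le {I A : Set α} (hI : IsLowerSet I) (hfin : A.Finite)
    (hne : A.Nonempty) (h : fixingSubgroup G A ≤ stabilizer G I) :
    ∃ a ∈ A, stabilizer G a ≤ stabilizer G I := by
  have htriv : fixingSubgroup G (∅ : Set α) ≤ stabilizer G I →
      ∃ a ∈ A, stabilizer G a ≤ stabilizer G I := fun h' =>
    ⟨hne.some, hne.some_mem, fun f _ => h' (by simp)⟩
  rw [← Set.inter_union_sdiff A I] at h
  rcases hG.fixingSubgroup_le_stabilizer_or hI Set.inter_subset_right (fun _ hx => hx.2) h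
    with h | h
  · rcases (A ∩ I).eq_empty_or_nonempty with hempty | hne'
    · exact htriv (hempty ▸ h)
    · obtain ⟨a, ha, hmax⟩ := Set.exists_max_image _ id (hfin.inter_of_left I) hne'
      exact ⟨a, ha.1, hG.stabilizer_le_of_isGreatest hI Set.inter_subset_right ⟨ha, hmax⟩ h⟩
  · rcases (A \ I).eq_empty_or_nonempty with hempty | hne'
    · exact htriv (hempty ▸ h)
    · obtain ⟨a, ha, hmin⟩ := Set.exists_min_image _ id (hfin.subset Set.sdiff_subset) hne'
      refine ⟨a, ha.1, ?_⟩
      have := hG.dual.stabilizer_le_of_isGreatest (I := OrderDual.ofDual ⁻¹' Iᶜ)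
        (A := OrderDual.ofDual ⁻¹' (A \ I)) (a := OrderDual.toDual a) hI.compl.toDual
        (fun _ hx => hx.2) ⟨ha, hmin⟩ (h.trans (stabilizer_compl G α).ge)
      exact this.trans (stabilizer_compl G α).le

end IsGlueClosed

end Gluing

section Models

variable {L : FirstOrder.Language.{u, v}} {lt : L.Relations 2} {T : L.Theory}

theorem IsTheoryOfLinearOrders.exists_linearOrder (hlinear : IsTheoryOfLinearOrders lt T)
    (N : Type (max u v)) [L.Structure N] [Nonempty N] [T.Model N] :
    ∃ _ : LinearOrder N, InterpretsLT lt N := by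
  classical
  have := hlinear (Theory.ModelType.of T N)
  exact ⟨@linearOrderOfSTO N (fun a b => RelMap lt ![a, b]) this _, fun a b => Iff.rfl⟩

theorem InterpretsLT.realize_lt {N : Type w} [L.Structure N] [LinearOrder N]
    (h : InterpretsLT lt N) {α : Type*} (i j : α) (x : α → N) :
    (lt.formula₂ (Term.var i) (Term.var j) : L.Formula α).Realize x ↔ x i < x j := by
  rw [Formula.realize_rel₂, Term.realize_var, Term.realize_var, h]

instance {N : Type w} [L.Structure N] : Group (N ≃[L] N) where
  mul σ τ := σ.comp τ
  one := Language.Equiv.refl L N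
  inv := Language.Equiv.symm
  mul_assoc _ _ _ := rfl
  one_mul _ := rfl
  mul_one _ := rfl
  inv_mul_cancel σ := σ.symm_comp_self

instance {N : Type w} [L.Structure N] : MulAction (N ≃[L] N) N where
  smul σ x := σ x
  one_smul _ := rfl
  mul_smul _ _ _ := rfl

theorem realize_smul_iff {N : Type w} [L.Structure N] {α : Type*} (σ : N ≃[L] N)
    (φ : L.Formula α) (x : α → N) : φ.Realize (σ • x) ↔ φ.Realize x :=
  StrongHomClass.realize_formula σ φ

theorem smul_sumElim_const {G γ κ N : Type*} [SMul G N] (g : G) (a : γ → N) (x : N) :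
    g • (Sum.elim a fun _ : κ => x) = Sum.elim (g • a) fun _ => g • x := by
  funext i
  cases i <;> rfl

theorem fixingSubgroup_range_le_stabilizer {N : Type w} [L.Structure N] {γ : Type*}
    (a : γ → N) (φ : L.Formula (γ ⊕ Fin 1)) :
    fixingSubgroup (N ≃[L] N) (Set.range a) ≤
      MulAction.stabilizer (N ≃[L] N) {x | φ.Realize (Sum.elim a fun _ => x)} := by
  intro σ hσ
  have hσa : σ • a = a := funext fun i => hσ ⟨a i, i, rfl⟩
  refine MulAction.mem_stabilizer_set.2 fun x => ?_
  rw [Set.mem_ofPred_eq, Set.mem_ofPred_eq, ← realize_smul_iff σ φ (Sum.elim a fun _ => x),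
    smul_sumElim_const, hσa]

theorem SLB.isGlueClosed (hSLB : SLB lt T) {N : Type (max u v)} [L.Structure N] [LinearOrder N]
    [Nonempty N] [T.Model N] (h : InterpretsLT lt N) : IsGlueClosed (N ≃[L] N) N where
  strictMono_smul σ x y hxy := by
    rw [← h] at hxy ⊢
    have := (σ.map_rel lt ![x, y]).2 hxy
    rwa [← FinVec.map_eq] at this
  exists_eq_on C hC σ hσ := hSLB N h C hC σ
    (MulAction.mem_stabilizer_iff.1 (MulAction.mem_stabilizer_set.2 hσ))

theorem exists_finset_forall_realize_of_smul_eq (hlinear : IsTheoryOfLinearOrders lt T)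
    (hSLB : SLB lt T) {M : Type w} [L.Structure M] [Nonempty M] [T.Model M] {β ι : Type}
    {J : Type*} (φ : L.Formula β) (s t : ι → J → β)
    (h : ∀ (N : Type (max u v)) [L.Structure N] [LinearOrder N], InterpretsLT lt N →
      IsGlueClosed (N ≃[L] N) N → ∀ (x : β → N) (σ : ι → N ≃[L] N),
        (∀ i j, σ i • x (s i j) = x (t i j)) → φ.Realize x) :
    ∃ Θ : Finset (L.Formula J), ∀ x : β → M,
      (∀ i, ∀ θ ∈ Θ, θ.Realize (x ∘ s i) ↔ θ.Realize (x ∘ t i)) → φ.Realize x :=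
  exists_finset_forall_realize_of_conjugate φ s t fun N _ _ hMN x σ hσ => by
    have := hMN.theory_model (T := T)
    obtain ⟨_, hN⟩ := hlinear.exists_linearOrder N
    exact h N hN (hSLB.isGlueClosed hN) x σ hσ

theorem comp_sumMap_const {α ι κ N : Type*} (z : α ⊕ ι → N) (c : ι) :
    z ∘ Sum.map id (fun _ : κ => c) = Sum.elim (z ∘ Sum.inl) fun _ => z (Sum.inr c) := by
  funext i
  cases i <;> rfl

theorem comp_vecPair {α N : Type*} (z : α → N) (i j : α) : z ∘ ![i, j] = ![z i, z j] :=
  (FinVec.map_eq z ![i, j]).symm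

/-- The formula expressing that `φ(a, ·)` defines an initial part, as a condition on `a`. -/
noncomputable def lowerSetFormula {γ : Type*} (lt : L.Relations 2) (φ : L.Formula (γ ⊕ Fin 1)) :
    L.Formula γ :=
  Formula.iAlls (Fin 2) ((lt.formula₂ (Term.var (Sum.inr 1)) (Term.var (Sum.inr 0))).imp
    ((φ.relabel (Sum.map id fun _ => 0)).imp (φ.relabel (Sum.map id fun _ => 1))))

theorem InterpretsLT.realize_lowerSetFormula {N : Type w} [L.Structure N] [LinearOrder N]
    (h : InterpretsLT lt N) {γ : Type*} (φ : L.Formula (γ ⊕ Fin 1)) (a : γ → N) :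
    (lowerSetFormula lt φ).Realize a ↔ IsLowerSet {x | φ.Realize (Sum.elim a fun _ => x)} := by
  simp only [lowerSetFormula, Formula.realize_iAlls, Formula.realize_imp, h.realize_lt,
    Formula.realize_relabel, comp_sumMap_const, isLowerSet_iff_forall_lt]
  exact ⟨fun hφ x y hyx => hφ ![x, y] hyx, fun hφ i hlt => hφ hlt⟩

variable {M : Type w} [L.Structure M] [LinearOrder M] [Nonempty M] [T.Model M]

theorem exists_finset_convex (hlinear : IsTheoryOfLinearOrders lt T) (hSLB : SLB lt T)
    (hM : InterpretsLT lt M) {γ : Type} (φ : L.Formula (γ ⊕ Fin 1)) :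
    ∃ (Θ : Finset (L.Formula (γ ⊕ Fin 1))) (Δ : Finset (L.Formula (Fin 1))),
      ∀ (a : γ → M) (x y x' : M), x < y → y < x' →
        (∀ θ ∈ Θ, θ.Realize (Sum.elim a fun _ => x) ↔ θ.Realize (Sum.elim a fun _ => x')) →
        (∀ δ ∈ Δ, δ.Realize (fun _ => x) ↔ δ.Realize (fun _ => y)) →
        φ.Realize (Sum.elim a fun _ => x) → φ.Realize (Sum.elim a fun _ => y) := by
  classical
  let var₃ (i : Fin 3) : L.Term (γ ⊕ Fin 3) := Term.var (Sum.inr i)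
  let at₃ (i : Fin 3) : L.Formula (γ ⊕ Fin 3) := φ.relabel (Sum.map id fun _ => i)
  obtain ⟨Θ, hΘ⟩ := exists_finset_forall_realize_of_smul_eq hlinear hSLB (M := M) (ι := Bool)
    ((lt.formula₂ (var₃ 0) (var₃ 1)).imp ((lt.formula₂ (var₃ 1) (var₃ 2)).imp
      ((at₃ 0).imp (at₃ 1))))
    (J := γ ⊕ Fin 1)
    (fun i => bif i then Sum.map id fun _ => 0 else fun _ => Sum.inr 0)
    (fun i => bif i then Sum.map id fun _ => 2 else fun _ => Sum.inr 1) (by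
      intro N _ _ hN hglue x σ hσ
      simp only [var₃, at₃, Formula.realize_imp, hN.realize_lt, Formula.realize_relabel,
        comp_sumMap_const]
      intro h01 h12 h0
      obtain ⟨k, hk, hkfix⟩ := hglue.exists_smul_eq_fixing (f := σ true) (g := σ false)
        (x := x (Sum.inr 0)) (h01.le.trans_eq (hσ false (Sum.inr 0)).symm)
        ((hσ false (Sum.inr 0)).trans_le (h12.le.trans_eq (hσ true (Sum.inr 0)).symm))
      have hk0 : k • x (Sum.inr 0) = x (Sum.inr 1) := hk.trans (hσ false (Sum.inr 0))
      have hka : k • (x ∘ Sum.inl) = x ∘ Sum.inl :=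
        funext fun i => hkfix _ (hσ true (Sum.inl i))
      rwa [← realize_smul_iff k, smul_sumElim_const, hka, hk0] at h0)
  refine ⟨Θ, Θ.image fun θ => θ.relabel fun _ => 0, fun a x y x' hxy hyx' hθ hδ hx => ?_⟩
  have hφ := hΘ (Sum.elim a ![x, y, x']) fun i θ hθΘ => by
    cases i with
    | true =>
      rw [cond_true, cond_true, comp_sumMap_const, comp_sumMap_const]
      exact hθ θ hθΘ
    | false =>
      have := hδ _ (Finset.mem_image_of_mem _ hθΘ)
      rwa [Formula.realize_relabel, Formula.realize_relabel] at this
  simp only [var₃, at₃, Formula.realize_imp, hM.realize_lt, Formula.realize_relabel,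
    comp_sumMap_const] at hφ
  exact hφ hxy hyx' hx

theorem exists_finset_separated (hlinear : IsTheoryOfLinearOrders lt T) (hSLB : SLB lt T)
    (hM : InterpretsLT lt M) (ψ : L.Formula (Fin 2)) :
    ∃ Θ : Finset (L.Formula (Fin 2)), ∀ x y y' z : M, (y ≤ x ∧ x < z) ∨ (z < x ∧ x ≤ y) →
      (∀ θ ∈ Θ, θ.Realize ![x, y] ↔ θ.Realize ![x, y']) →
      ψ.Realize ![y, z] → ψ.Realize ![y', z] := by
  let below : L.Formula (Fin 4) :=
    (lt.formula₂ (Term.var 0) (Term.var 1)).not ⊓ lt.formula₂ (Term.var 0) (Term.var 3)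
  let above : L.Formula (Fin 4) :=
    lt.formula₂ (Term.var 3) (Term.var 0) ⊓ (lt.formula₂ (Term.var 1) (Term.var 0)).not
  obtain ⟨Θ, hΘ⟩ := exists_finset_forall_realize_of_smul_eq hlinear hSLB (M := M) (ι := Unit)
    ((below ⊔ above).imp ((ψ.relabel ![1, 3]).imp (ψ.relabel ![2, 3])))
    (fun _ => ![0, 1]) (fun _ => ![0, 2]) (by
      intro N _ _ hN hglue x σ hσ
      simp only [below, above, Formula.realize_imp, Formula.realize_sup, Formula.realize_inf,
        Formula.realize_not, hN.realize_lt, not_lt, Formula.realize_relabel, comp_vecPair]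
      intro hsep h
      suffices ∃ τ : N ≃[L] N, τ • x 1 = x 2 ∧ τ • x 3 = x 3 by
        obtain ⟨τ, h1, h3⟩ := this
        rwa [← realize_smul_iff τ, Matrix.smul_vec2, h1, h3] at h
      have h0 : σ () • x 0 = x 0 := hσ () 0
      have h1 : σ () • x 1 = x 2 := hσ () 1
      rcases hsep with ⟨h10, h03⟩ | ⟨h30, h01⟩
      · obtain ⟨τ, hle, hlt⟩ := hglue.exists_eq_on_Iic h0
        exact ⟨τ, (hle _ h10).trans h1, hlt _ h03⟩
      · obtain ⟨τ, hge, hlt⟩ := hglue.exists_eq_on_Ici h0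
        exact ⟨τ, (hge _ h01).trans h1, hlt _ h30⟩)
  refine ⟨Θ, fun x y y' z hsep hθ hy => ?_⟩
  have hψ := hΘ ![x, y, y', z] fun _ θ hθΘ => by
    rw [comp_vecPair, comp_vecPair]
    exact hθ θ hθΘ
  simp only [below, above, Formula.realize_imp, Formula.realize_sup, Formula.realize_inf,
    Formula.realize_not, hM.realize_lt, not_lt, Formula.realize_relabel, comp_vecPair] at hψ
  exact hψ hsep hy

theorem exists_finset_isLowerSet (hlinear : IsTheoryOfLinearOrders lt T) (hSLB : SLB lt T)
    (hM : InterpretsLT lt M) {γ : Type} [Finite γ] [Nonempty γ] (φ : L.Formula (γ ⊕ Fin 1)) :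
    ∃ Θ : Finset (L.Formula (Fin 2)), ∀ a : γ → M,
      IsLowerSet {x | φ.Realize (Sum.elim a fun _ => x)} →
      ∃ i, ∀ x x' : M, (∀ θ ∈ Θ, θ.Realize ![a i, x] ↔ θ.Realize ![a i, x']) →
        φ.Realize (Sum.elim a fun _ => x) → φ.Realize (Sum.elim a fun _ => x') := by
  let left (i : γ) : L.Formula (γ ⊕ (γ ⊕ γ)) := φ.relabel (Sum.map id fun _ => Sum.inl i)
  let right (i : γ) : L.Formula (γ ⊕ (γ ⊕ γ)) := φ.relabel (Sum.map id fun _ => Sum.inr i)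
  obtain ⟨Θ, hΘ⟩ := exists_finset_forall_realize_of_smul_eq hlinear hSLB (M := M)
    (((lowerSetFormula lt φ).relabel Sum.inl).imp (Formula.iSup fun i => (left i).imp (right i)))
    (fun i => ![Sum.inl i, Sum.inr (Sum.inl i)]) (fun i => ![Sum.inl i, Sum.inr (Sum.inr i)]) (by
      intro N _ _ hN hglue x σ hσ
      simp only [left, right, Formula.realize_imp, Formula.realize_relabel, Formula.realize_iSup,
        hN.realize_lowerSetFormula, comp_sumMap_const]
      intro hI
      obtain ⟨_, ⟨i, rfl⟩, hi⟩ := hglue.exists_stabilizer_le hI (Set.finite_range _)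
        (Set.range_nonempty _) (fixingSubgroup_range_le_stabilizer _ φ)
      refine ⟨i, fun hxi => ?_⟩
      have hx : σ i • x (Sum.inr (Sum.inl i)) = x (Sum.inr (Sum.inr i)) := hσ i 1
      exact hx ▸ (MulAction.mem_stabilizer_set.1 (hi (hσ i 0)) _).2 hxi)
  refine ⟨Θ, fun a hlower => ?_⟩
  by_contra! hcon
  choose x x' hθ hx hx' using hcon
  have hφ := hΘ (Sum.elim a (Sum.elim x x')) fun i θ hθΘ => by
    rw [comp_vecPair, comp_vecPair]
    exact hθ i θ hθΘ
  simp only [left, right, Formula.realize_imp, Formula.realize_relabel, Formula.realize_iSup,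
    hM.realize_lowerSetFormula, comp_sumMap_const] at hφ
  obtain ⟨i, hi⟩ := hφ hlower
  exact hx' i (hi (hx i))

end Models

section Definability

variable {L : FirstOrder.Language.{u, v}} {M : Type w} [L.Structure M] {A : Set M} {α : Type}

/-- A predicate of assignments is definable with parameters from `A`. This lets a formula be
written as the predicate it defines. -/
def DefinablePred (L : FirstOrder.Language.{u, v}) {M : Type w} [L.Structure M] (A : Set M)
    {α : Type} (R : (α → M) → Prop) : Prop :=
  A.Definable L {x | R x}

namespace DefinablePred

variable {R S : (α → M) → Prop}

theorem and (hR : DefinablePred L A R) (hS : DefinablePred L A S) :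
    DefinablePred L A fun x => R x ∧ S x :=
  Set.Definable.inter hR hS

theorem or (hR : DefinablePred L A R) (hS : DefinablePred L A S) :
    DefinablePred L A fun x => R x ∨ S x :=
  Set.Definable.union hR hS

theorem not (hR : DefinablePred L A R) : DefinablePred L A fun x => ¬R x :=
  Set.Definable.compl hR

theorem congr (hR : DefinablePred L A R) (h : ∀ x, R x ↔ S x) : DefinablePred L A S :=
  (funext fun x => propext (h x) : R = S) ▸ hR

theorem imp (hR : DefinablePred L A R) (hS : DefinablePred L A S) :
    DefinablePred L A fun x => R x → S x :=
  (hR.not.or hS).congr fun _ => imp_iff_not_or.symm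

theorem exists_ {n : ℕ} {R : M → (Fin n → M) → Prop}
    (hR : DefinablePred L A fun x : Fin (n + 1) → M => R (x 0) fun i => x i.succ) :
    DefinablePred L A fun x => ∃ y, R y x := by
  refine (show DefinablePred L A _ from Set.Definable.exists_of_finite
    (Set.Definable.preimage_comp (β := Fin n ⊕ Fin 1) (Fin.cons (Sum.inr 0) Sum.inl) hR)).congr
    fun x => ⟨?_, ?_⟩
  · rintro ⟨y, hy⟩
    exact ⟨y 0, hy⟩
  · rintro ⟨y, hy⟩
    exact ⟨fun _ => y, hy⟩

theorem forall_ {n : ℕ} {R : M → (Fin n → M) → Prop}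
    (hR : DefinablePred L A fun x : Fin (n + 1) → M => R (x 0) fun i => x i.succ) :
    DefinablePred L A fun x => ∀ y, R y x :=
  (exists_ (R := fun y x => ¬R y x) hR.not).not.congr fun _ => not_exists_not

theorem of_definable₁ {P : Set M} (hP : A.Definable₁ L P) (i : α) :
    DefinablePred L A fun x : α → M => x i ∈ P :=
  Set.Definable.preimage_comp (fun _ => i) hP

theorem of_definable₂ {R : M → M → Prop} (hR : A.Definable₂ L {p : M × M | R p.1 p.2}) (i j : α) :
    DefinablePred L A fun x : α → M => R (x i) (x j) :=
  Set.Definable.preimage_comp ![i, j] hR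

theorem equal (i j : α) : DefinablePred L A fun x : α → M => x i = x j :=
  Set.Definable.preimage_comp ![i, j] (Set.Definable.diagonal L A)

theorem le [LinearOrder M] (hlt : A.Definable₂ L {p : M × M | p.1 < p.2}) (i j : α) :
    DefinablePred L A fun x : α → M => x i ≤ x j :=
  (of_definable₂ hlt j i).not.congr fun _ => not_lt

end DefinablePred

theorem InterpretsLT.definable₂_lt {lt : L.Relations 2} [LinearOrder M] (hM : InterpretsLT lt M)
    (A : Set M) : A.Definable₂ L {p : M × M | p.1 < p.2} := by
  refine Set.Definable.mono (Set.empty_definable_iff.2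
    ⟨lt.formula₂ (Term.var 0) (Term.var 1), ?_⟩) (Set.empty_subset A)
  ext x
  exact (hM.realize_lt 0 1 x).symm

theorem definable₂_formula (ψ : L.Formula (Fin 2)) :
    (∅ : Set M).Definable₂ L {p : M × M | ψ.Realize ![p.1, p.2]} := by
  refine Set.empty_definable_iff.2 ⟨ψ, ?_⟩
  ext x
  exact iff_of_eq (congrArg ψ.Realize (List.ofFn_inj.1 rfl))

theorem isUnaryDefinable_formula (δ : L.Formula (Fin 1)) :
    IsUnaryDefinable L {x : M | δ.Realize fun _ => x} := by
  refine Set.empty_definable_iff.2 ⟨δ, ?_⟩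
  ext x
  exact iff_of_eq (congrArg δ.Realize (List.ofFn_inj.1 rfl))

theorem exists_formula_of_separated {ι : Type*} (Θ : Finset (L.Formula α)) (f : ι → α → M)
    {I : Set ι} (hI : ∀ i j, (∀ θ ∈ Θ, θ.Realize (f i) ↔ θ.Realize (f j)) → i ∈ I → j ∈ I) :
    ∃ ψ : L.Formula α, I = {i | ψ.Realize (f i)} := by
  classical
  let type (i : ι) : Set Θ := {θ | θ.1.Realize (f i)}
  have eq_type_iff (i : ι) (τ : Set Θ) :
      (Formula.iInf fun θ : Θ => if θ ∈ τ then θ.1 else θ.1.not).Realize (f i) ↔ type i = τ := by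
    rw [Formula.realize_iInf, Set.ext_iff]
    refine forall_congr' fun θ => ?_
    by_cases hθ : θ ∈ τ <;> simp [hθ, type]
  refine ⟨Formula.iSup fun τ : type '' I => Formula.iInf fun θ : Θ =>
    if θ ∈ τ.1 then θ.1 else θ.1.not, ?_⟩
  ext j
  simp only [Set.mem_ofPred_eq, Formula.realize_iSup, eq_type_iff]
  constructor
  · exact fun hj => ⟨⟨_, j, hj, rfl⟩, rfl⟩
  · rintro ⟨⟨_, i, hi, rfl⟩, hji⟩
    exact hI i j (fun θ hθ => (Set.ext_iff.1 hji ⟨θ, hθ⟩).symm) hi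

theorem exists_formula_of_definable₁ [Nonempty M] {D : Set M} (hD : A.Definable₁ L D) :
    ∃ (n : ℕ) (a : Fin (n + 1) → M) (φ : L.Formula (Fin (n + 1) ⊕ Fin 1)),
      D = {x | φ.Realize (Sum.elim a fun _ => x)} := by
  obtain ⟨m⟩ := ‹Nonempty M›
  obtain ⟨A₀, -, hA₀⟩ := Set.definable_iff_finitely_definable.1 hD
  obtain ⟨φ, hφ⟩ := Set.definable_iff_exists_formula_sum.1 hA₀
  let e := A₀.equivFin
  refine ⟨_, Fin.cons m fun i => e.symm i, φ.relabel (Sum.map (Fin.succ ∘ e) id), ?_⟩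
  ext x
  rw [Set.mem_ofPred_eq, Formula.realize_relabel, Sum.elim_comp_map]
  refine (Set.ext_iff.1 hφ fun _ => x).trans (iff_of_eq (congrArg φ.Realize ?_))
  congr 1
  funext i
  exact congrArg Subtype.val (e.symm_apply_apply i).symm

end Definability

section Height

variable {α : Type*} {r : α → α → Prop} {S S' : Set α} {k : ℕ} {x y z : α}

/-- The elements of `S` that are the last element of an `r`-chain with `k + 1` elements in `S`. -/
def heightGE (r : α → α → Prop) (S : Set α) : ℕ → Set α
  | 0 => S
  | k + 1 => {y ∈ S | ∃ x ∈ heightGE r S k, r x y}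

/-- The elements of `S` of height exactly `k`: the longest `r`-chains in `S` that they end have
`k + 1` elements. -/
def heightEq (r : α → α → Prop) (S : Set α) (k : ℕ) : Set α :=
  heightGE r S k \ heightGE r S (k + 1)

theorem heightGE_subset (r : α → α → Prop) (S : Set α) (k : ℕ) : heightGE r S k ⊆ S := by
  cases k with
  | zero => exact Set.Subset.rfl
  | succ k => exact fun _ hx => hx.1

theorem heightGE_antitone (r : α → α → Prop) (S : Set α) : Antitone (heightGE r S) := by
  refine antitone_nat_of_succ_le fun k => ?_
  induction k with
  | zero => exact heightGE_subset r S 1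
  | succ k ih => exact fun _ ⟨hx, y, hy, hyx⟩ => ⟨hx, y, ih hy, hyx⟩

theorem heightEq_subset (r : α → α → Prop) (S : Set α) (k : ℕ) : heightEq r S k ⊆ S :=
  fun _ hx => heightGE_subset r S k hx.1

theorem mem_heightGE_of_forall (hx : x ∈ heightGE r S k) (hz : z ∈ S) (h : ∀ y, r y x → r y z) :
    z ∈ heightGE r S k := by
  cases k with
  | zero => exact hz
  | succ k =>
    obtain ⟨-, y, hy, hyx⟩ := hx
    exact ⟨hz, y, hy, h y hyx⟩

theorem mem_heightGE_of_subset [IsTrans α r] (hx : x ∈ heightGE r S k) (hxS' : x ∈ S')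
    (h : ∀ y ∈ S, r y x → y ∈ S') : x ∈ heightGE r S' k := by
  induction k generalizing x with
  | zero => exact hxS'
  | succ k ih =>
    obtain ⟨-, y, hy, hyx⟩ := hx
    exact ⟨hxS', y, ih hy (h y (heightGE_subset r S k hy) hyx) fun z hz hzy =>
      h z hz (_root_.trans hzy hyx), hyx⟩

theorem not_rel_of_mem_heightEq (hx : x ∈ heightEq r S k) (hy : y ∈ heightEq r S k) : ¬r x y :=
  fun hxy => hy.2 ⟨heightEq_subset r S k hy, x, hx.1, hxy⟩

theorem pairwise_disjoint_heightEq (r : α → α → Prop) (S : Set α) :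
    Pairwise fun i j => Disjoint (heightEq r S i) (heightEq r S j) :=
  (pairwise_disjoint_on _).2 fun _ _ hij => Set.disjoint_left.2 fun _ hi hj =>
    hi.2 (heightGE_antitone r S hij hj.1)

theorem exists_mem_heightEq {m : ℕ} (hx : x ∈ S) (hm : x ∉ heightGE r S m) :
    ∃ j < m, x ∈ heightEq r S j := by
  induction m with
  | zero => exact absurd hx hm
  | succ m ih =>
    by_cases h : x ∈ heightGE r S m
    · exact ⟨m, m.lt_succ_self, h, hm⟩
    · obtain ⟨j, hj, hxj⟩ := ih h
      exact ⟨j, hj.trans m.lt_succ_self, hxj⟩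

theorem lt_card_of_mem_heightGE [IsTrans α r] {κ : Type*} [Finite κ] (c : α → κ)
    (hc : ∀ x ∈ S, ∀ y ∈ S, r x y → c x ≠ c y) (hx : x ∈ heightGE r S k) : k < Nat.card κ := by
  suffices h : k < (c '' {y ∈ S | y = x ∨ r y x}).ncard from h.trans_le (Set.ncard_le_card _)
  induction k generalizing x with
  | zero => exact (Set.ncard_pos (Set.toFinite _)).2 ⟨c x, x, ⟨hx, Or.inl rfl⟩, rfl⟩
  | succ k ih =>
    obtain ⟨hxS, y, hy, hyx⟩ := hx
    have below_x {z : α} (hz : z = y ∨ r z y) : r z x :=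
      hz.elim (fun h => h ▸ hyx) fun h => _root_.trans h hyx
    refine (Nat.succ_le_of_lt (ih hy)).trans_lt (Set.ncard_lt_ncard ⟨?_, fun h => ?_⟩)
    · exact Set.image_mono fun z hz => ⟨hz.1, Or.inr (below_x hz.2)⟩
    · obtain ⟨z, ⟨hzS, hz⟩, hzx⟩ := h ⟨x, ⟨hxS, Or.inl rfl⟩, rfl⟩
      exact hc z hzS x hxS (below_x hz) hzx

variable {L : FirstOrder.Language.{u, v}} {M : Type w} [L.Structure M] {A : Set M}

theorem definable₂_heightGE {r : M → M → Prop} (hr : A.Definable₂ L {p : M × M | r p.1 p.2})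
    {S : M → Set M} (hS : A.Definable₂ L {p : M × M | p.2 ∈ S p.1}) (k : ℕ) :
    A.Definable₂ L {p : M × M | p.2 ∈ heightGE r (S p.1) k} := by
  induction k with
  | zero => exact hS
  | succ k ih =>
    exact DefinablePred.and hS <| .exists_ <|
      (DefinablePred.of_definable₂ (R := fun x y => y ∈ heightGE r (S x) k) ih 1 0).and
        (.of_definable₂ hr 0 2)

theorem definable₂_heightEq {r : M → M → Prop} (hr : A.Definable₂ L {p : M × M | r p.1 p.2})
    {S : M → Set M} (hS : A.Definable₂ L {p : M × M | p.2 ∈ S p.1}) (k : ℕ) :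
    A.Definable₂ L {p : M × M | p.2 ∈ heightEq r (S p.1) k} :=
  DefinablePred.and (definable₂_heightGE hr hS k) (definable₂_heightGE hr hS (k + 1)).compl

theorem definable₁_heightEq {r : M → M → Prop} (hr : A.Definable₂ L {p : M × M | r p.1 p.2})
    {S : Set M} (hS : A.Definable₁ L S) (k : ℕ) : A.Definable₁ L (heightEq r S k) :=
  DefinablePred.of_definable₂ (R := fun _ y => y ∈ heightEq r S k)
    (definable₂_heightEq hr (S := fun _ => S) (DefinablePred.of_definable₁ hS 1) k) 0 0

end Height

section Families

variable {α : Type w} [LinearOrder α] {B : α → Set α} {k : ℕ} {x y z v w : α}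

/-- The indices of the members of a family of sets that are relevant at `x`: the sets indexed by
points up to `x` which contain `x`. -/
def indicesAt (B : α → Set α) (x : α) : Set α :=
  {w | w ≤ x ∧ x ∈ B w}

/-- The indices of the sets relevant at `x` above which there is a chain of `k` larger relevant
sets, but no longer one. -/
def indicesOfRank (B : α → Set α) (k : ℕ) (x : α) : Set α :=
  heightEq (B ⁻¹'o (· > ·)) (indicesAt B x) k

theorem eq_of_mem_indicesOfRank (hB : ∀ w, IsLowerSet (B w)) (hv : v ∈ indicesOfRank B k x)
    (hw : w ∈ indicesOfRank B k x) : B v = B w := by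
  rcases (hB v).total (hB w) with h | h
  · exact eq_of_le_of_not_lt h (not_rel_of_mem_heightEq (r := B ⁻¹'o (· > ·)) hw hv)
  · exact (eq_of_le_of_not_lt h (not_rel_of_mem_heightEq (r := B ⁻¹'o (· > ·)) hv hw)).symm

theorem mem_heightGE_indicesAt_of_le (hxy : x ≤ y) (hy : y ∈ B w)
    (hw : w ∈ heightGE (B ⁻¹'o (· > ·)) (indicesAt B x) k) :
    w ∈ heightGE (B ⁻¹'o (· > ·)) (indicesAt B y) k :=
  mem_heightGE_of_subset hw ⟨(heightGE_subset _ _ _ hw).1.trans hxy, hy⟩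
    fun _ hv hwv => ⟨hv.1.trans hxy, hwv.le hy⟩

theorem mem_indicesOfRank_of_mem_Icc (hB : ∀ w, IsLowerSet (B w)) (hv : v ∈ indicesOfRank B k x)
    (hw : w ∈ indicesOfRank B k z) (hvw : B v = B w) (hy : y ∈ Set.Icc x z) :
    v ∈ indicesOfRank B k y := by
  have hwz : w ∈ indicesAt B z := heightEq_subset _ _ _ hw
  have hz : z ∈ B v := hvw ▸ hwz.2
  refine ⟨mem_heightGE_indicesAt_of_le hy.1 (hB v hy.2 hz) hv.1, fun hvy => hw.2 ?_⟩
  refine mem_heightGE_of_forall (mem_heightGE_indicesAt_of_le hy.2 hz hvy) hwz fun u huv => ?_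
  exact hvw.symm.trans_lt huv

/-- Two points are equivalent if the sets of rank `k` at them coincide. A point at which no set has
rank `k` is equivalent to itself only. -/
def rankSetoid (B : α → Set α) (hB : ∀ w, IsLowerSet (B w)) (k : ℕ) : Setoid α where
  r x y := x = y ∨ ∃ v ∈ indicesOfRank B k x, ∃ w ∈ indicesOfRank B k y, B v = B w
  iseqv := by
    refine ⟨fun x => Or.inl rfl, ?_, ?_⟩
    · rintro x y (rfl | ⟨v, hv, w, hw, hvw⟩)
      · exact Or.inl rfl
      · exact Or.inr ⟨w, hw, v, hv, hvw.symm⟩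
    · rintro x y z (rfl | ⟨v, hv, w, hw, hvw⟩) (rfl | ⟨v', hv', w', hw', hvw'⟩)
      · exact Or.inl rfl
      · exact Or.inr ⟨v', hv', w', hw', hvw'⟩
      · exact Or.inr ⟨v, hv, w, hw, hvw⟩
      · exact Or.inr ⟨v, hv, w', hw', hvw.trans ((eq_of_mem_indicesOfRank hB hw hv').trans hvw')⟩

theorem ordConnected_rankSetoid (hB : ∀ w, IsLowerSet (B w)) (k : ℕ) (a : α) :
    {x | rankSetoid B hB k x a}.OrdConnected := by
  refine ⟨fun x hx z hz y hy => ?_⟩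
  suffices rankSetoid B hB k y x from (rankSetoid B hB k).trans this hx
  rcases (rankSetoid B hB k).trans hx ((rankSetoid B hB k).symm hz) with rfl | ⟨v, hv, w, hw, hvw⟩
  · exact Or.inl (le_antisymm hy.2 hy.1)
  · exact Or.inr ⟨v, mem_indicesOfRank_of_mem_Icc hB hv hw hvw hy, v, hv, rfl⟩

/-- The rank of `B a` at the points of `B a` increases and is bounded, hence is eventually constant:
`x₀` is a point where it is maximal. -/
theorem exists_rank_eq_Iio_union_class (hB : ∀ w, IsLowerSet (B w)) {κ : Type*} [Finite κ]
    (c : α → α → κ)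
    (hc : ∀ x, ∀ v ∈ indicesAt B x, ∀ w ∈ indicesAt B x, c x v = c x w → B v ⊆ B w)
    {a : α} (ha : a ∈ B a) : ∃ k x₀, B a = Set.Iio x₀ ∪ {x | rankSetoid B hB k x x₀} := by
  classical
  let P (k : ℕ) : Prop := ∃ x, a ∈ heightGE (B ⁻¹'o (· > ·)) (indicesAt B x) k
  have hbound (k : ℕ) (hk : P k) : k ≤ Nat.card κ := by
    obtain ⟨x, hx⟩ := hk
    exact (lt_card_of_mem_heightGE (c x) (fun v hv w hw hvw hcol =>
      hvw.not_ge (hc x v hv w hw hcol)) hx).le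
  let k := Nat.findGreatest P (Nat.card κ)
  obtain ⟨x₀, hx₀⟩ : P k := Nat.findGreatest_spec (Nat.zero_le _) ⟨a, le_rfl, ha⟩
  have hrank (x : α) (hx : x₀ ≤ x) (hax : x ∈ B a) : a ∈ indicesOfRank B k x :=
    ⟨mem_heightGE_indicesAt_of_le hx hax hx₀, fun h =>
      (Nat.le_findGreatest (hbound _ ⟨x, h⟩) ⟨x, h⟩).not_gt k.lt_succ_self⟩
  have ha₀ : x₀ ∈ B a := (heightGE_subset _ _ _ hx₀).2
  refine ⟨k, x₀, Set.ext fun x => ⟨fun hx => (lt_or_ge x x₀).imp_right fun h => ?_, ?_⟩⟩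
  · exact Or.inr ⟨a, hrank x h hx, a, hrank x₀ le_rfl ha₀, rfl⟩
  · rintro (h | rfl | ⟨v, hv, w, hw, hvw⟩)
    · exact hB a h.le ha₀
    · exact ha₀
    · rw [eq_of_mem_indicesOfRank hB (hrank x₀ le_rfl ha₀) hw, ← hvw]
      exact (heightEq_subset _ _ _ hv).2

section

variable {L : FirstOrder.Language.{u, v}} [L.Structure α]

theorem isDefinableConvexEquiv_rankSetoid
    (hlt : (∅ : Set α).Definable₂ L {p : α × α | p.1 < p.2})
    (hdef : (∅ : Set α).Definable₂ L {p : α × α | p.2 ∈ B p.1}) (hB : ∀ w, IsLowerSet (B w))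
    (k : ℕ) : IsDefinableConvexEquiv L (rankSetoid B hB k) := by
  refine ⟨?_, ordConnected_rankSetoid hB k⟩
  have hsub {m : ℕ} (i j : Fin m) :
      DefinablePred L (∅ : Set α) fun x : Fin m → α => B (x i) ⊆ B (x j) :=
    .forall_ ((DefinablePred.of_definable₂ (R := fun w z => z ∈ B w) hdef i.succ 0).imp
      (.of_definable₂ hdef j.succ 0))
  have hind : (∅ : Set α).Definable₂ L {p : α × α | p.2 ∈ indicesAt B p.1} :=
    (DefinablePred.le hlt 1 0).and (.of_definable₂ (R := fun w z => z ∈ B w) hdef 1 0)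
  have hrank : (∅ : Set α).Definable₂ L {p : α × α | p.2 ∈ indicesOfRank B k p.1} :=
    definable₂_heightEq (r := B ⁻¹'o (· > ·)) ((hsub 1 0).and (hsub 0 1).not) hind k
  have hmem {m : ℕ} (i j : Fin m) :
      DefinablePred L (∅ : Set α) fun x : Fin m → α => x i ∈ indicesOfRank B k (x j) :=
    .of_definable₂ (R := fun x w => w ∈ indicesOfRank B k x) hrank j i
  exact (DefinablePred.equal 0 1).or <| .exists_ <| .and (hmem 0 1) <| .exists_ <|
    .and (hmem 0 3) <| ((hsub 1 0).and (hsub 0 1)).congr fun _ => Set.Subset.antisymm_iff.symm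

theorem exists_eq_Iio_union_class (hlt : (∅ : Set α).Definable₂ L {p : α × α | p.1 < p.2})
    {R : α → α → Prop} (hR : (∅ : Set α).Definable₂ L {p : α × α | R p.1 p.2})
    {κ : Type*} [Finite κ] (c : α → α → κ)
    (hc : ∀ x w w' z, w ≤ x → w' ≤ x → x < z → c x w = c x w' → R w z → R w' z)
    {d : α} (hlower : IsLowerSet {z | R d z}) (hd : R d d) :
    ∃ E, IsDefinableConvexEquiv L E ∧ ∃ x₀, {z | R d z} = Set.Iio x₀ ∪ {x | E x x₀} := by
  let B (w : α) : Set α := {x | x ≤ w ∨ ∃ z, R w z ∧ x ≤ z}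
  have hB (w : α) : IsLowerSet (B w) := fun x y hyx hx =>
    hx.imp hyx.trans fun ⟨z, hz, hxz⟩ => ⟨z, hz, hyx.trans hxz⟩
  have hdef : (∅ : Set α).Definable₂ L {p : α × α | p.2 ∈ B p.1} :=
    (DefinablePred.le hlt 1 0).or
      (.exists_ ((DefinablePred.of_definable₂ hR 1 0).and (.le hlt 2 0)))
  have hBd : {z | R d z} = B d := Set.ext fun z => ⟨fun hz => Or.inr ⟨z, hz, le_rfl⟩, fun hz =>
    hz.elim (fun h => hlower h hd) fun ⟨_, ht, hzt⟩ => hlower hzt ht⟩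
  obtain ⟨k, x₀, hx₀⟩ := exists_rank_eq_Iio_union_class hB c
    (fun x w hw w' hw' hcol z hz => by
      rcases le_or_gt z x with hzx | hxz
      · exact hB w' hzx hw'.2
      rcases hz with hz | ⟨t, ht, hzt⟩
      · exact absurd (hz.trans hw.1) hxz.not_ge
      · exact Or.inr ⟨t, hc x w w' t hw.1 hw'.1 (hxz.trans_le hzt) hcol ht, hzt⟩)
    (a := d) (Or.inl le_rfl)
  exact ⟨_, isDefinableConvexEquiv_rankSetoid hlt hdef hB k, x₀, hBd.trans hx₀⟩

theorem exists_eq_Ioi_union_class (hlt : (∅ : Set α).Definable₂ L {p : α × α | p.1 < p.2})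
    {R : α → α → Prop} (hR : (∅ : Set α).Definable₂ L {p : α × α | R p.1 p.2})
    {κ : Type*} [Finite κ] (c : α → α → κ)
    (hc : ∀ x w w' z, x ≤ w → x ≤ w' → z < x → c x w = c x w' → R w z → R w' z)
    {d : α} (hupper : IsUpperSet {z | R d z}) (hd : R d d) :
    ∃ E, IsDefinableConvexEquiv L E ∧ ∃ x₀, {z | R d z} = Set.Ioi x₀ ∪ {x | E x x₀} := by
  let _ : L.Structure αᵒᵈ := inferInstanceAs (L.Structure α)
  obtain ⟨E, ⟨hE, hconvex⟩, x₀, hx₀⟩ := exists_eq_Iio_union_class (α := αᵒᵈ) (L := L) (R := R)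
    (DefinablePred.of_definable₂ hlt 1 0) hR c hc hupper hd
  exact ⟨E, ⟨hE, fun a => (hconvex a).dual⟩, x₀, hx₀⟩

end

end Families

section InitialParts

variable {L : FirstOrder.Language.{u, v}} {lt : L.Relations 2} {T : L.Theory}
  {M : Type w} [L.Structure M] [LinearOrder M]

theorem IsRay.ordConnected {I : Set M} (hI : IsRay I) : I.OrdConnected := by
  obtain ⟨a, rfl | rfl⟩ := hI
  exacts [Set.ordConnected_Ioi, Set.ordConnected_Iio]

theorem IsDefinableConvexClass.ordConnected {K : Set M} (hK : IsDefinableConvexClass L K) :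
    K.OrdConnected := by
  obtain ⟨E, hE, a, rfl⟩ := hK
  exact hE.2 a

/-- The generators of the Boolean algebra of sets in the theorem: definable sets, open rays and
classes of definable convex equivalence relations. -/
def basicSets (L : FirstOrder.Language.{u, v}) (M : Type w) [L.Structure M] [LinearOrder M] :
    Set (Set M) :=
  {S | IsUnaryDefinable L S ∨ IsRay S ∨ IsDefinableConvexClass L S}

theorem ray_union_class_mem_closure_basicSets {I : Set M} (hI : IsRay I) {E : Setoid M}
    (hE : IsDefinableConvexEquiv L E) (a : M) :
    I ∪ {x | E x a} ∈ BooleanSubalgebra.closure (basicSets L M) :=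
  BooleanSubalgebra.sup_mem (BooleanSubalgebra.subset_closure (Or.inr (Or.inl hI)))
    (BooleanSubalgebra.subset_closure (Or.inr (Or.inr ⟨E, hE, a, rfl⟩)))

variable [Nonempty M] [T.Model M]

theorem exists_eq_realize_of_isLowerSet (hlinear : IsTheoryOfLinearOrders lt T)
    (hSLB : SLB lt T) (hM : InterpretsLT lt M) {A I : Set M} (hI : IsLowerSet I)
    (hA : A.Definable₁ L I) : ∃ (d : M) (ψ : L.Formula (Fin 2)), I = {x | ψ.Realize ![d, x]} := by
  obtain ⟨n, a, φ, rfl⟩ := exists_formula_of_definable₁ hA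
  obtain ⟨Θ, hΘ⟩ := exists_finset_isLowerSet hlinear hSLB hM φ
  obtain ⟨i, hi⟩ := hΘ a hI
  exact ⟨a i, exists_formula_of_separated Θ (fun x => ![a i, x]) hi⟩

theorem mem_closure_basicSets_of_isLowerSet (hlinear : IsTheoryOfLinearOrders lt T)
    (hSLB : SLB lt T) (hM : InterpretsLT lt M) {A I : Set M} (hI : IsLowerSet I)
    (hA : A.Definable₁ L I) : I ∈ BooleanSubalgebra.closure (basicSets L M) := by
  obtain ⟨d, ψ, rfl⟩ := exists_eq_realize_of_isLowerSet hlinear hSLB hM hI hA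
  obtain ⟨Θ, hΘ⟩ := exists_finset_separated hlinear hSLB hM ψ
  let color (x w : M) (θ : Θ) : Prop := θ.1.Realize ![x, w]
  have realize_iff {x w w' : M} (h : color x w = color x w') :
      ∀ θ ∈ Θ, θ.Realize ![x, w] ↔ θ.Realize ![x, w'] :=
    fun θ hθ => iff_of_eq (congrFun h ⟨θ, hθ⟩)
  have hlt := hM.definable₂_lt ∅
  have hψ : (∅ : Set M).Definable₂ L {p : M × M | ψ.Realize ![p.1, p.2]} := definable₂_formula ψ
  by_cases hd : ψ.Realize ![d, d]
  · obtain ⟨E, hE, x₀, hx₀⟩ := exists_eq_Iio_union_class hlt hψ color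
      (fun x w w' z hw _ hz h => hΘ x w w' z (Or.inl ⟨hw, hz⟩) (realize_iff h)) hI hd
    rw [hx₀]
    exact ray_union_class_mem_closure_basicSets ⟨x₀, Or.inr rfl⟩ hE x₀
  · obtain ⟨E, hE, x₀, hx₀⟩ := exists_eq_Ioi_union_class (R := fun w z => ¬ψ.Realize ![w, z]) hlt
      (DefinablePred.not hψ) color
      (fun x w w' z _ hw' hz h =>
        mt (hΘ x w' w z (Or.inr ⟨hz, hw'⟩) (realize_iff h.symm))) hI.compl hd
    rw [← BooleanSubalgebra.compl_mem_iff]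
    change {z | ¬ψ.Realize ![d, z]} ∈ _
    rw [hx₀]
    exact ray_union_class_mem_closure_basicSets ⟨x₀, Or.inl rfl⟩ hE x₀

end InitialParts

section Components

variable {M : Type w} [LinearOrder M] {P D : Set M} {k : ℕ} {x y z : M}

/-- `y` lies in a later convex component of `D ∩ P` in `P` than `x`, for `x` and `y` in `D ∩ P`. -/
def ComponentLT (P D : Set M) (x y : M) : Prop :=
  ∃ z ∈ P, x < z ∧ z < y ∧ z ∉ D

instance : IsTrans M (ComponentLT P D) :=
  ⟨fun _ _ _ ⟨z, hz, hxz, hzy, hzD⟩ ⟨_, _, hyt, htw, _⟩ =>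
    ⟨z, hz, hxz, hzy.trans (hyt.trans htw), hzD⟩⟩

/-- The convex component of `D ∩ P` in `P` preceded by exactly `k` convex components. -/
def nthComponent (P D : Set M) (k : ℕ) : Set M :=
  heightEq (ComponentLT P D) (D ∩ P) k

theorem nthComponent_subset (P D : Set M) (k : ℕ) : nthComponent P D k ⊆ D ∩ P :=
  heightEq_subset _ _ _

theorem mem_nthComponent_of_mem_Icc (hx : x ∈ nthComponent P D k) (hy : y ∈ nthComponent P D k)
    (hz : z ∈ P) (hxz : x ≤ z) (hzy : z ≤ y) : z ∈ nthComponent P D k := by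
  have hzD : z ∈ D := by
    rcases hxz.eq_or_lt with rfl | hxz
    · exact (nthComponent_subset P D k hx).1
    rcases hzy.eq_or_lt with rfl | hzy
    · exact (nthComponent_subset P D k hy).1
    by_contra hzD
    exact not_rel_of_mem_heightEq hx hy ⟨z, hz, hxz, hzy, hzD⟩
  have componentLT_mono {u v w : M} (hvw : v ≤ w) :
      ComponentLT P D u v → ComponentLT P D u w := fun ⟨t, ht, hut, htv, htD⟩ =>
    ⟨t, ht, hut, htv.trans_le hvw, htD⟩
  exact ⟨mem_heightGE_of_forall hx.1 ⟨hzD, hz⟩ fun _ => componentLT_mono hxz, fun h =>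
    hy.2 (mem_heightGE_of_forall h (nthComponent_subset P D k hy) fun _ => componentLT_mono hzy)⟩

theorem exists_mem_nthComponent {κ : Type*} [Finite κ] (c : M → κ)
    (hc : ∀ x ∈ P, ∀ y ∈ P, ∀ x' ∈ P, x < y → y < x' → c x = c x' → x ∈ D → y ∈ D)
    (hx : x ∈ D ∩ P) : ∃ k < Nat.card κ, x ∈ nthComponent P D k :=
  exists_mem_heightEq hx fun h => (lt_card_of_mem_heightGE c
    (fun x hx y hy ⟨z, hz, hxz, hzy, hzD⟩ hxy => hzD (hc x hx.2 z hz y hy.2 hxz hzy hxy hx.1))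
    h).false

variable {L : FirstOrder.Language.{u, v}} [L.Structure M] {A : Set M}

theorem isDefinablyConvex_nthComponent (hP : IsUnaryDefinable L P) (D : Set M) (k : ℕ) :
    IsDefinablyConvex L (nthComponent P D k) :=
  ⟨P, hP, fun _ hx => (nthComponent_subset P D k hx).2, fun _ hx _ hy _ hz hxz hzy =>
    mem_nthComponent_of_mem_Icc hx hy hz hxz hzy⟩

theorem definable₁_nthComponent (hlt : A.Definable₂ L {p : M × M | p.1 < p.2})
    (hP : A.Definable₁ L P) (hD : A.Definable₁ L D) (k : ℕ) :
    A.Definable₁ L (nthComponent P D k) := by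
  have componentLT : A.Definable₂ L {p : M × M | ComponentLT P D p.1 p.2} :=
    DefinablePred.exists_ <| (DefinablePred.of_definable₁ hP 0).and <|
      (DefinablePred.of_definable₂ hlt 1 0).and <| (DefinablePred.of_definable₂ hlt 0 2).and <|
      (DefinablePred.of_definable₁ hD 0).not
  exact definable₁_heightEq (r := ComponentLT P D) (S := D ∩ P) componentLT
    (Set.Definable.inter hD hP) k

end Components

section Decomposition

theorem exists_finpartition_of_pairwise_disjoint {α ι : Type*} [Finite ι] {D : Set α}
    {K : ι → Set α} (hK : Pairwise fun i j => Disjoint (K i) (K j)) (hD : ⋃ i, K i = D) :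
    ∃ Q : Finpartition D, ∀ S ∈ Q.parts, ∃ i, S = K i := by
  classical
  have := Fintype.ofFinite ι
  have hsup : (Finset.univ.image K).sup id = D := by
    rw [Finset.sup_image, Function.id_comp, ← hD, ← Set.iSup_eq_iUnion, Finset.sup_univ_eq_iSup]
  refine ⟨(Finpartition.ofPairwiseDisjoint (Finset.univ.image K) ?_).copy hsup, fun S hS => ?_⟩
  · rintro S hS S' hS' hne
    obtain ⟨i, -, rfl⟩ := Finset.mem_image.1 hS
    obtain ⟨j, -, rfl⟩ := Finset.mem_image.1 hS'
    exact hK fun h => hne (congrArg K h)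
  · obtain ⟨i, -, rfl⟩ := Finset.mem_image.1 (Finset.mem_of_mem_erase hS)
    exact ⟨i, rfl⟩

variable {L : FirstOrder.Language.{u, v}} {lt : L.Relations 2} {T : L.Theory} {M : Type w}
  [L.Structure M]

/-- The elements of `M` satisfying exactly the formulas of `τ` among those of `Δ`. -/
def typeLocus (M : Type w) [L.Structure M] {Δ : Finset (L.Formula (Fin 1))} (τ : Set Δ) : Set M :=
  {x | {δ : Δ | δ.1.Realize fun _ => x} = τ}

theorem isUnaryDefinable_typeLocus {Δ : Finset (L.Formula (Fin 1))} (τ : Set Δ) :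
    IsUnaryDefinable L (typeLocus M τ) := by
  obtain ⟨ψ, hψ⟩ := exists_formula_of_separated (I := typeLocus M τ) Δ (fun x _ => x)
    fun x y hxy hx => (Set.ext fun δ : Δ => (hxy δ.1 δ.2).symm).trans hx
  exact hψ ▸ isUnaryDefinable_formula ψ

theorem IsUnaryDefinable.mem_of_locus [Nonempty M] [T.Model M] {P : Set M}
    (hP : IsUnaryDefinable L P) {q : T.CompleteType (Fin 1)} {x y : M} (hx : x ∈ locus M q)
    (hy : y ∈ locus M q) (hxP : x ∈ P) : y ∈ P := by
  obtain ⟨φ, hφ⟩ := Set.empty_definable_iff.1 hP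
  have mem_iff (z : M) : z ∈ P ↔ φ.Realize fun _ : Fin 1 => z := Set.ext_iff.1 hφ fun _ => z
  have htype : T.typeOf (fun _ : Fin 1 => x) = T.typeOf (fun _ : Fin 1 => y) := hx.trans hy.symm
  rw [mem_iff, ← Theory.CompleteType.formula_mem_typeOf (T := T)] at hxP ⊢
  rwa [← htype]

variable [LinearOrder M] [Nonempty M] [T.Model M]

theorem exists_finpartition_definablyConvex (hlinear : IsTheoryOfLinearOrders lt T)
    (hSLB : SLB lt T) (hM : InterpretsLT lt M) {A D : Set M} (hD : A.Definable₁ L D) :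
    ∃ Q : Finpartition D, ∀ S ∈ Q.parts, A.Definable₁ L S ∧ IsDefinablyConvex L S := by
  obtain ⟨n, a, φ, hφ⟩ := exists_formula_of_definable₁ hD
  obtain ⟨Θ, Δ, hΘΔ⟩ := exists_finset_convex hlinear hSLB hM φ
  let color (x : M) (θ : Θ) : Prop := θ.1.Realize (Sum.elim a fun _ => x)
  have hcolor (τ : Set Δ) (x) (hx : x ∈ typeLocus M τ) (y) (hy : y ∈ typeLocus M τ) (x')
      (_ : x' ∈ typeLocus M τ) (hxy : x < y) (hyx' : y < x') (h : color x = color x')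
      (hxD : x ∈ D) : y ∈ D := by
    rw [hφ] at hxD ⊢
    exact hΘΔ a x y x' hxy hyx' (fun θ hθ => iff_of_eq (congrFun h ⟨θ, hθ⟩))
      (fun δ hδ => Set.ext_iff.1 (hx.trans hy.symm) ⟨δ, hδ⟩) hxD
  let K (p : Set Δ × Fin (Nat.card (Θ → Prop))) : Set M := nthComponent (typeLocus M p.1) D p.2
  have hK : Pairwise fun p q => Disjoint (K p) (K q) := by
    rintro ⟨τ, i⟩ ⟨τ', j⟩ hne
    refine Set.disjoint_left.2 fun x hx hx' => ?_
    obtain rfl : τ = τ' :=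
      (nthComponent_subset _ _ _ hx).2.symm.trans (nthComponent_subset _ _ _ hx').2
    refine Set.disjoint_left.1 (pairwise_disjoint_heightEq _ _ fun hij => hne ?_) hx hx'
    exact congrArg (Prod.mk τ) (Fin.ext hij)
  have hKD : ⋃ p, K p = D := by
    refine Set.Subset.antisymm (Set.iUnion_subset fun p x hx => (nthComponent_subset _ _ _ hx).1)
      fun x hx => ?_
    obtain ⟨k, hk, hxk⟩ := exists_mem_nthComponent color (hcolor _) (x := x) ⟨hx, rfl⟩
    exact Set.mem_iUnion.2 ⟨⟨_, k, hk⟩, hxk⟩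
  obtain ⟨Q, hQ⟩ := exists_finpartition_of_pairwise_disjoint hK hKD
  refine ⟨Q, fun S hS => ?_⟩
  obtain ⟨⟨τ, k⟩, rfl⟩ := hQ S hS
  have hτ : IsUnaryDefinable L (typeLocus M τ) := isUnaryDefinable_typeLocus τ
  exact ⟨definable₁_nthComponent (hM.definable₂_lt A) (hτ.mono (Set.empty_subset A)) hD k,
    isDefinablyConvex_nthComponent hτ D k⟩

theorem mem_closure_basicSets_of_definablyConvex (hlinear : IsTheoryOfLinearOrders lt T)
    (hSLB : SLB lt T) (hM : InterpretsLT lt M) {A S : Set M} (hS : A.Definable₁ L S)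
    (hconvex : IsDefinablyConvex L S) : S ∈ BooleanSubalgebra.closure (basicSets L M) := by
  obtain ⟨P, hP, hSP, hconvex⟩ := hconvex
  have hlt := hM.definable₂_lt A
  have hdown : {x | ∃ s, s ∈ S ∧ x ≤ s} ∈ BooleanSubalgebra.closure (basicSets L M) :=
    mem_closure_basicSets_of_isLowerSet hlinear hSLB hM (A := A)
      (fun x y hyx ⟨s, hs, hxs⟩ => ⟨s, hs, hyx.trans hxs⟩)
      (DefinablePred.exists_ ((DefinablePred.of_definable₁ hS 0).and (.le hlt 1 0)))
  have hbelow : {x | ∀ s, s ∈ S → x < s} ∈ BooleanSubalgebra.closure (basicSets L M) :=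
    mem_closure_basicSets_of_isLowerSet hlinear hSLB hM (A := A)
      (fun x y hyx hx s hs => hyx.trans_lt (hx s hs))
      (DefinablePred.forall_ ((DefinablePred.of_definable₁ hS 0).imp (.of_definable₂ hlt 1 0)))
  have hPmem : P ∈ BooleanSubalgebra.closure (basicSets L M) :=
    BooleanSubalgebra.subset_closure (Or.inl hP)
  have hS_eq : S = P ⊓ ({x | ∃ s, s ∈ S ∧ x ≤ s} \ {x | ∀ s, s ∈ S → x < s}) := by
    ext x
    constructor
    · exact fun hx => ⟨hSP hx, ⟨x, hx, le_rfl⟩, fun h => (h x hx).false⟩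
    · rintro ⟨hxP, ⟨s, hs, hxs⟩, hx⟩
      simp only [Set.mem_ofPred_eq, not_forall, not_lt] at hx
      obtain ⟨t, ht, htx⟩ := hx
      exact hconvex t ht s hs x hxP htx hxs
  rw [hS_eq]
  exact BooleanSubalgebra.inf_mem hPmem (BooleanSubalgebra.sdiff_mem hdown hbelow)

theorem mem_closure_basicSets (hlinear : IsTheoryOfLinearOrders lt T) (hSLB : SLB lt T)
    (hM : InterpretsLT lt M) {A D : Set M} (hD : A.Definable₁ L D) :
    D ∈ BooleanSubalgebra.closure (basicSets L M) := by
  obtain ⟨Q, hQ⟩ := exists_finpartition_definablyConvex hlinear hSLB hM hD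
  rw [← Q.sup_parts]
  exact Finset.sup_induction BooleanSubalgebra.bot_mem
    (fun _ h _ h' => BooleanSubalgebra.sup_mem h h')
    fun S hS => mem_closure_basicSets_of_definablyConvex hlinear hSLB hM (hQ S hS).1 (hQ S hS).2

theorem finite_convexComponentsOn_locus {D : Set M} (Q : Finpartition D)
    (hQ : ∀ S ∈ Q.parts, IsDefinablyConvex L S) (q : T.CompleteType (Fin 1)) :
    (convexComponentsOn (locus M q) D).Finite := by
  let meeting (S : Set M) : Set (Set (locus M q)) :=
    {K | ∃ x : locus M q, (x : M) ∈ S ∧ K = Set.ordConnectedComponent (Subtype.val ⁻¹' D) x}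
  have hmeeting : ∀ S ∈ Q.parts, (meeting S).Subsingleton := by
    rintro S hS _ ⟨x, hx, rfl⟩ _ ⟨y, hy, rfl⟩
    obtain ⟨P, hP, hSP, hconvex⟩ := hQ S hS
    refine Set.ordConnectedComponent_eq fun z hz => Q.le hS ?_
    have hzP : (z : M) ∈ P := hP.mem_of_locus x.2 z.2 (hSP hx)
    rcases Set.mem_uIcc.1 hz with ⟨hxz, hzy⟩ | ⟨hyz, hzx⟩
    · exact hconvex x hx y hy z hzP hxz hzy
    · exact hconvex y hy x hx z hzP hyz hzx
  refine (Q.parts.finite_toSet.biUnion fun S hS => (hmeeting S hS).finite).subset ?_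
  rintro K ⟨x, hx, rfl⟩
  rw [← Q.sup_parts, Finset.sup_set_eq_biUnion, Set.mem_iUnion₂] at hx
  obtain ⟨S, hS, hxS⟩ := hx
  exact Set.mem_biUnion hS ⟨x, hxS, rfl⟩

theorem isWeaklyQuasiOMinimal (hlinear : IsTheoryOfLinearOrders lt T) (hSLB : SLB lt T) :
    IsWeaklyQuasiOMinimal.{u, v, w} lt T := by
  intro M _ _ _ _ hM D hD
  refine BooleanSubalgebra.closure_mono ?_ (mem_closure_basicSets hlinear hSLB hM hD)
  exact fun S hS => hS.imp_right fun h =>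
    h.elim IsRay.ordConnected IsDefinableConvexClass.ordConnected

end Decomposition

end LinearTheory

theorem mainTheorem11_general {L : FirstOrder.Language.{u, v}} (lt : L.Relations 2)
    (T : L.Theory) (hlinear : LinearTheory.IsTheoryOfLinearOrders lt T)
    (hSLB : LinearTheory.SLB lt T) :
    (∀ (M : Type w) [L.Structure M] [LinearOrder M] [Nonempty M] [T.Model M],
      LinearTheory.InterpretsLT lt M →
      ∀ (A D : Set M), A.Definable₁ L D →
        D ∈ BooleanSubalgebra.closure
          {S : Set M | LinearTheory.IsUnaryDefinable L S ∨ LinearTheory.IsRay S ∨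
            LinearTheory.IsDefinableConvexClass L S} ∧
        (∀ q : T.CompleteType (Fin 1),
          (LinearTheory.convexComponentsOn (LinearTheory.locus M q) D).Finite) ∧
        ∃ Q : Finpartition D, ∀ S ∈ Q.parts,
          A.Definable₁ L S ∧ LinearTheory.IsDefinablyConvex L S) ∧
    LinearTheory.IsWeaklyQuasiOMinimal.{u, v, w} lt T := by
  refine ⟨fun M _ _ _ _ hM A D hD => ?_, LinearTheory.isWeaklyQuasiOMinimal hlinear hSLB⟩
  obtain ⟨Q, hQ⟩ := LinearTheory.exists_finpartition_definablyConvex hlinear hSLB hM hD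
  exact ⟨LinearTheory.mem_closure_basicSets hlinear hSLB hM hD,
    LinearTheory.finite_convexComponentsOn_locus Q fun S hS => (hQ S hS).2, Q, hQ⟩

theorem mainTheorem11 {L : FirstOrder.Language.{u, v}} (lt : L.Relations 2)
    (T : L.Theory) (hcomplete : T.IsComplete)
    (hlinear : LinearTheory.IsTheoryOfLinearOrders lt T)
    (hinfinite : LinearTheory.HasInfiniteModel T)
    (hSLB : LinearTheory.SLB lt T) :
    (∀ (M : Type w) [L.Structure M] [LinearOrder M] [Nonempty M] [T.Model M],
      LinearTheory.InterpretsLT lt M →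
      ∀ (A D : Set M), A.Definable₁ L D →
        D ∈ BooleanSubalgebra.closure
          {S : Set M | LinearTheory.IsUnaryDefinable L S ∨ LinearTheory.IsRay S ∨
            LinearTheory.IsDefinableConvexClass L S} ∧
        (∀ q : T.CompleteType (Fin 1),
          (LinearTheory.convexComponentsOn (LinearTheory.locus M q) D).Finite) ∧
        ∃ Q : Finpartition D, ∀ S ∈ Q.parts,
          A.Definable₁ L S ∧ LinearTheory.IsDefinablyConvex L S) ∧
    LinearTheory.IsWeaklyQuasiOMinimal.{u, v, w} lt T :=
  mainTheorem11_general lt T hlinear hSLB
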